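/- Let $M$ be a type II$_1$ factor (acting on a Hilbert space, with its faithful normal tracial state $\tau$), and let $N\subseteq K\subseteq M$, $N\subseteq L\subseteq M$ be II$_1$ subfactors (with the same unit) forming a commuting square, i.e. the $\tau$-preserving conditional expectations of $M$ satisfy $E_KE_L=E_N=E_LE_K$. Suppose that the Jones indices satisfy $[K:N]=[M:L]<\infty$, where for an inclusion $A\subseteq B$ of II$_1$ factors $[B:A]=\dim_A L^2(B)$. Then the commuting square is non-degenerate: with closures in the strong operator topology, $$\overline{\operatorname{span}}\{KL\}=M=\overline{\operatorname{span}}\{LK\}.$$ Moreover, every finite Pimsner–Popa basis for $K/N$ is also a Pimsner–Popa basis for $M/L$; that is, if $\lambda_1,\dots,\lambda_n\in K$ satisfy $x=\sum_i E^K_N(x\lambda_i^*)\lambda_i$ for all $x\in K$, then $x=\sum_i E^M_L(x\lambda_i^*)\lambda_i$ for all $x\in M$. -/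

import Mathlib

open scoped InnerProductSpace ComplexOrder ENNReal Pointwise

namespace VonNeumannAlgebra

/-! ### A von Neumann algebra as an ordered C⋆-algebra -/

theorem exists_star_mul_self_of_spectrum {A : Type*} [CStarAlgebra A] {x : A}
    (hsa : IsSelfAdjoint x) (hsp : SpectrumRestricts x ContinuousMap.realToNNReal) :
    ∃ s : A, x = star s * s := by
  let _ : PartialOrder A := CStarAlgebra.spectralOrder A
  have : StarOrderedRing A := CStarAlgebra.spectralOrderedRing A
  exact CStarAlgebra.nonneg_iff_eq_star_mul_self.1
    (nonneg_iff_isSelfAdjoint_and_quasispectrumRestricts.2 ⟨hsa, hsp⟩)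

variable {H : Type*} [NormedAddCommGroup H] [InnerProductSpace ℂ H] [CompleteSpace H]

instance isClosed_toStarSubalgebra (M : VonNeumannAlgebra H) :
    IsClosed (M.toStarSubalgebra : Set (H →L[ℂ] H)) := by
  rw [coe_toStarSubalgebra, ← M.centralizer_centralizer]
  exact Set.isClosed_centralizer _

theorem exists_eq_star_mul_self (M : VonNeumannAlgebra H) {x : M.toStarSubalgebra} (hx : 0 ≤ x) :
    ∃ s : M.toStarSubalgebra, x = star s * s := by
  have hx' : (0 : H →L[ℂ] H) ≤ (x : H →L[ℂ] H) := hx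
  refine exists_star_mul_self_of_spectrum (Subtype.ext (IsSelfAdjoint.of_nonneg hx').star_eq) ?_
  rw [SpectrumRestricts.nnreal_iff]
  intro r hr
  have h1 : algebraMap ℝ ℂ r ∈ spectrum ℂ x := by
    rw [spectrum.algebraMap_mem_iff ℂ]; exact hr
  rw [StarSubalgebra.spectrum_eq] at h1
  have h2 : r ∈ spectrum ℝ (x : H →L[ℂ] H) := by
    rw [← spectrum.algebraMap_mem_iff ℂ]; exact h1
  exact spectrum_nonneg_of_nonneg hx' h2

/-- The operator order on a von Neumann algebra: its nonnegative elements are the `star s * s`. -/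
instance starOrderedRing_toStarSubalgebra (M : VonNeumannAlgebra H) :
    StarOrderedRing M.toStarSubalgebra :=
  StarOrderedRing.of_nonneg_iff' (fun {x y} h z => by
      change (z : H →L[ℂ] H) + x ≤ z + y
      have h' : (x : H →L[ℂ] H) ≤ y := h
      gcongr)
    (fun x => ⟨fun h => M.exists_eq_star_mul_self h, by
      rintro ⟨s, rfl⟩
      exact star_mul_self_nonneg (s : H →L[ℂ] H)⟩)

/-! ### Traces and factors of type II₁ -/

/-- A faithful normal tracial state on a von Neumann algebra. Normality is ultraweak continuity:
`τ x = ∑ ⟨η n, x (ξ n)⟩` for square-summable sequences of vectors `ξ` and `η`. -/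
structure FaithfulNormalTrace (M : VonNeumannAlgebra H) where
  toLinearMap : M.toStarSubalgebra →ₗ[ℂ] ℂ
  map_one : toLinearMap 1 = 1
  map_star_mul_self_nonneg : ∀ x, 0 ≤ toLinearMap (star x * x)
  faithful : ∀ x, toLinearMap (star x * x) = 0 → x = 0
  map_mul_comm : ∀ x y, toLinearMap (x * y) = toLinearMap (y * x)
  normal : ∃ ξ η : ℕ → H, Summable (fun n => ‖ξ n‖ ^ 2) ∧ Summable (fun n => ‖η n‖ ^ 2) ∧
    ∀ x : M.toStarSubalgebra,
      HasSum (fun n => ⟪η n, (x : H →L[ℂ] H) (ξ n)⟫_ℂ) (toLinearMap x)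

/-- A factor of type II₁: an infinite-dimensional von Neumann algebra with trivial centre and
a faithful normal tracial state. -/
structure IsII1Factor (M : VonNeumannAlgebra H) : Prop where
  center_trivial : ∀ x ∈ M, x ∈ M.commutant → ∃ c : ℂ, x = c • (1 : H →L[ℂ] H)
  infinite_dimensional : ¬ FiniteDimensional ℂ M.toStarSubalgebra
  exists_trace : Nonempty M.FaithfulNormalTrace

namespace FaithfulNormalTrace

variable {M N : VonNeumannAlgebra H}

/-- The restriction of a trace to a von Neumann subalgebra. -/
noncomputable def restrict (τ : M.FaithfulNormalTrace) (h : N ≤ M) : N.FaithfulNormalTrace where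
  toLinearMap := τ.toLinearMap ∘ₗ
    (StarSubalgebra.inclusion (S₁ := N.toStarSubalgebra) (S₂ := M.toStarSubalgebra)
      (fun _ hx => h hx)).toAlgHom.toLinearMap
  map_one := τ.map_one
  map_star_mul_self_nonneg x := τ.map_star_mul_self_nonneg ⟨x, h x.2⟩
  faithful x hx := Subtype.ext
    (congrArg (Subtype.val : M.toStarSubalgebra → H →L[ℂ] H) (τ.faithful ⟨x, h x.2⟩ hx))
  map_mul_comm x y := τ.map_mul_comm ⟨x, h x.2⟩ ⟨y, h y.2⟩
  normal := by
    obtain ⟨ξ, η, hξ, hη, hs⟩ := τ.normal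
    exact ⟨ξ, η, hξ, hη, fun x => hs ⟨x, h x.2⟩⟩

/-! ### The standard representation `L²(M, τ)` and the Jones index -/

/-- A trace as a positive linear functional. -/
noncomputable def toPositiveLinearMap (τ : M.FaithfulNormalTrace) :
    M.toStarSubalgebra →ₚ[ℂ] ℂ :=
  PositiveLinearMap.mk₀ τ.toLinearMap fun x hx => by
    obtain ⟨s, rfl⟩ := M.exists_eq_star_mul_self hx
    exact τ.map_star_mul_self_nonneg s

/-- The Hilbert space `L²(M, τ)`: the completion of `M` for `⟪x, y⟫ = τ (star x * y)`. -/
abbrev L2 (τ : M.FaithfulNormalTrace) := τ.toPositiveLinearMap.GNS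

/-- An element of `M` as a vector of `L²(M, τ)`. -/
noncomputable def vec (τ : M.FaithfulNormalTrace) (x : M.toStarSubalgebra) : τ.L2 :=
  ((τ.toPositiveLinearMap.toPreGNS x : τ.toPositiveLinearMap.PreGNS) : τ.L2)

/-- The action of `M` on `L²(M, τ)` by left multiplication. -/
noncomputable def leftRep (τ : M.FaithfulNormalTrace) :
    M.toStarSubalgebra →⋆ₐ[ℂ] (τ.L2 →L[ℂ] τ.L2) :=
  τ.toPositiveLinearMap.gnsStarAlgHom

theorem leftRep_vec (τ : M.FaithfulNormalTrace) (x y : M.toStarSubalgebra) :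
    τ.leftRep x (τ.vec y) = τ.vec (x * y) :=
  τ.toPositiveLinearMap.gnsNonUnitalStarAlgHom_apply_coe (a := x)
    (b := τ.toPositiveLinearMap.toPreGNS y)

/-- The commutant `N'` of `N ⊆ M` in the bounded operators on `L²(M, τ)`. -/
noncomputable def commutantL2 (τ : M.FaithfulNormalTrace) (N : VonNeumannAlgebra H) :
    VonNeumannAlgebra τ.L2 where
  toStarSubalgebra :=
    StarSubalgebra.centralizer ℂ {a | ∃ x : M.toStarSubalgebra, (x : H →L[ℂ] H) ∈ N ∧
      τ.leftRep x = a}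
  centralizer_centralizer' := by
    change Set.centralizer (Set.centralizer (SetLike.coe (StarSubalgebra.centralizer ℂ _))) =
      SetLike.coe (StarSubalgebra.centralizer ℂ _)
    rw [StarSubalgebra.coe_centralizer, Set.centralizer_centralizer_centralizer]

/-- The closed subspace `L²(N)` of `L²(M, τ)`. -/
noncomputable def subspaceL2 (τ : M.FaithfulNormalTrace) (N : VonNeumannAlgebra H) :
    Submodule ℂ τ.L2 :=
  (Submodule.span ℂ {v | ∃ x : M.toStarSubalgebra, (x : H →L[ℂ] H) ∈ N ∧
    τ.vec x = v}).topologicalClosure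

instance (τ : M.FaithfulNormalTrace) (N : VonNeumannAlgebra H) :
    CompleteSpace (τ.subspaceL2 N) :=
  (Submodule.isClosed_topologicalClosure _).completeSpace_coe

/-- The Jones projection `e_N`, the orthogonal projection of `L²(M, τ)` onto `L²(N)`. -/
noncomputable def jonesProj (τ : M.FaithfulNormalTrace) (N : VonNeumannAlgebra H) :
    τ.L2 →L[ℂ] τ.L2 :=
  (τ.subspaceL2 N).starProjection

theorem leftRep_mem_subspaceL2 (τ : M.FaithfulNormalTrace) (N : VonNeumannAlgebra H)
    {x : M.toStarSubalgebra} (hx : (x : H →L[ℂ] H) ∈ N) {v : τ.L2} (hv : v ∈ τ.subspaceL2 N) :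
    τ.leftRep x v ∈ τ.subspaceL2 N := by
  have hmaps : Set.MapsTo (τ.leftRep x)
      (Submodule.span ℂ {v | ∃ x : M.toStarSubalgebra, (x : H →L[ℂ] H) ∈ N ∧ τ.vec x = v})
      (Submodule.span ℂ {v | ∃ x : M.toStarSubalgebra, (x : H →L[ℂ] H) ∈ N ∧ τ.vec x = v}) := by
    intro w hw
    induction hw using Submodule.span_induction with
    | mem w hw =>
      obtain ⟨y, hy, rfl⟩ := hw
      rw [leftRep_vec]
      exact Submodule.subset_span ⟨x * y, mul_mem hx hy, rfl⟩
    | zero => simp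
    | add w z _ _ hw hz => rw [map_add]; exact add_mem hw hz
    | smul c w _ hw => rw [map_smul]; exact Submodule.smul_mem _ c hw
  exact hmaps.closure (τ.leftRep x).continuous hv

theorem jonesProj_mem_commutantL2 (τ : M.FaithfulNormalTrace) (N : VonNeumannAlgebra H) :
    τ.jonesProj N ∈ (τ.commutantL2 N).toStarSubalgebra := by
  have key : ∀ x : M.toStarSubalgebra, (x : H →L[ℂ] H) ∈ N →
      τ.leftRep x * τ.jonesProj N = τ.jonesProj N * τ.leftRep x := by
    intro x hx
    ext v
    change τ.leftRep x ((τ.subspaceL2 N).starProjection v) =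
      (τ.subspaceL2 N).starProjection (τ.leftRep x v)
    refine (Submodule.eq_starProjection_of_mem_of_inner_eq_zero
      (τ.leftRep_mem_subspaceL2 N hx (Submodule.starProjection_apply_mem _ v)) ?_).symm
    intro w hw
    have hstar : ((star x : M.toStarSubalgebra) : H →L[ℂ] H) ∈ N := star_mem (s := N) hx
    have hw' := τ.leftRep_mem_subspaceL2 N hstar hw
    rw [map_star, ContinuousLinearMap.star_eq_adjoint] at hw'
    rw [← map_sub, ← ContinuousLinearMap.adjoint_inner_right]
    exact Submodule.starProjection_inner_eq_zero v _ hw'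
  change _ ∈ StarSubalgebra.centralizer ℂ _
  rw [StarSubalgebra.mem_centralizer_iff]
  rintro _ ⟨x, hx, rfl⟩
  refine ⟨key x hx, ?_⟩
  rw [← map_star]
  exact key (star x) (star_mem (s := N) hx)

open Classical in
/-- The Jones index `[M : N]`, that is, the coupling constant `dim_N L²(M)`. It is infinite when
the commutant `N'` on `L²(M)` is not finite; otherwise it is the reciprocal of the trace of the
Jones projection `e_N` with respect to the normalized trace of `N'`. -/
noncomputable def jonesIndex (τ : M.FaithfulNormalTrace) (N : VonNeumannAlgebra H) : ℝ≥0∞ :=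
  if h : Nonempty (τ.commutantL2 N).FaithfulNormalTrace then
    (ENNReal.ofReal
      ((h.some.toLinearMap ⟨τ.jonesProj N, τ.jonesProj_mem_commutantL2 N⟩).re))⁻¹
  else ⊤

/-! ### Conditional expectations, commuting squares and bases -/

/-- `E` is the trace-preserving conditional expectation of `M` onto `N`: a `⋆`- and
trace-preserving `N`-`N`-bimodule retraction. -/
structure IsCondExp (τ : M.FaithfulNormalTrace) (N : VonNeumannAlgebra H)
    (E : M.toStarSubalgebra →ₗ[ℂ] M.toStarSubalgebra) : Prop where
  mem : ∀ x, (E x : H →L[ℂ] H) ∈ N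
  eq_self : ∀ x : M.toStarSubalgebra, (x : H →L[ℂ] H) ∈ N → E x = x
  map_star : ∀ x, E (star x) = star (E x)
  map_mul_mul : ∀ a x b : M.toStarSubalgebra, (a : H →L[ℂ] H) ∈ N → (b : H →L[ℂ] H) ∈ N →
    E (a * x * b) = a * E x * b
  trace_map : ∀ x, τ.toLinearMap (E x) = τ.toLinearMap x

/-- A finite Pimsner–Popa basis of `M` over `N`. -/
def IsPimsnerPopaBasis (τ : M.FaithfulNormalTrace) (N : VonNeumannAlgebra H) {n : ℕ}
    (b : Fin n → M.toStarSubalgebra) : Prop :=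
  ∃ E : M.toStarSubalgebra →ₗ[ℂ] M.toStarSubalgebra, τ.IsCondExp N E ∧
    ∀ x, x = ∑ i, E (x * star (b i)) * b i

/-- The quadruple `N ⊆ K ⊆ M`, `N ⊆ L ⊆ M` is a commuting square: the trace-preserving conditional
expectations satisfy `E_K E_L = E_N = E_L E_K`. -/
structure IsCommutingSquare (τ : M.FaithfulNormalTrace) (N K L : VonNeumannAlgebra H) :
    Prop where
  N_le_K : N ≤ K
  N_le_L : N ≤ L
  K_le_M : K ≤ M
  L_le_M : L ≤ M
  commute : ∃ EN EK EL : M.toStarSubalgebra →ₗ[ℂ] M.toStarSubalgebra,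
    τ.IsCondExp N EN ∧ τ.IsCondExp K EK ∧ τ.IsCondExp L EL ∧
      EK ∘ₗ EL = EN ∧ EL ∘ₗ EK = EN

end FaithfulNormalTrace

/-- The closure of a set of operators in the strong operator topology. -/
def strongClosure (S : Set (H →L[ℂ] H)) : Set (H →L[ℂ] H) :=
  ContinuousLinearMap.toPointwiseConvergenceCLM ℂ (RingHom.id ℂ) H H ⁻¹'
    closure (ContinuousLinearMap.toPointwiseConvergenceCLM ℂ (RingHom.id ℂ) H H '' S)

/-- Non-degeneracy of a quadruple: the closed linear spans of `KL` and of `LK` are both `M`. -/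
def IsNondegenerate (M K L : VonNeumannAlgebra H) : Prop :=
  strongClosure (Submodule.span ℂ ((K : Set (H →L[ℂ] H)) * (L : Set (H →L[ℂ] H))) :
      Set (H →L[ℂ] H)) = M ∧
    strongClosure (Submodule.span ℂ ((L : Set (H →L[ℂ] H)) * (K : Set (H →L[ℂ] H))) :
      Set (H →L[ℂ] H)) = M

end VonNeumannAlgebra

/-! The index enters only through the trace of a Jones projection. Finiteness of `[M:L]` means that
the commutant `P` of `L` on `L²(M)` carries a faithful normal trace `tr`, with `tr(e_L) = [M:L]⁻¹`.
Right multiplications `R(b)` and `e_L` lie in `P`, and a finite family `b` has the frame operator `F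
= ∑ R(b i) e_L R(b i)*`, which implements `x ↦ ∑ E_L(x (b i)*) b i`. Since `e_L R(a) e_L = R(E_L a)
e_L`, its trace is `(∑ τ(b i (b i)*)) · tr(e_L)` (`map_frame`). If the `b i` lie in `K`, their frame
operator over `N` on `L²(K)` has trace given by the same sum times `[K:N]⁻¹`. Equal indices
therefore make the two traces equal (`map_frame_inclusion`), while the commuting square gives `E_L =
E_N` on `K`, so that algebraic relations between the `b i` also carry over. Hence what exhausts
`L²(K)` over `N` exhausts `L²(M)` over `L`.

For a Pimsner–Popa basis of `K/N` the frame operator over `N` is `1`. Over `L` it is then an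
idempotent of trace one, and faithfulness makes it `1` (`eq_frame_expansion`).

For non-degeneracy no finite basis is constructed. Families in `K` that are orthogonal for `E_N`,
with norms at most one, have frame operators of trace tending to one (`exists_subOrthonormal`). Over
`L` these satisfy `F² ≤ F`, so `‖1 - F‖₂² ≤ 1 - tr F → 0` and `∑ E_L(x (b i)*) b i → x` in `L²(M)`.
The push-down lemma `exists_vec_eq_apply` bounds these sums in operator norm, and a bounded
`L²`-limit is a strong limit (`frame_expansion_tendsto`). So `x` is in the strong closure of the
span of `LK`; adjoints give `KL`.

The push-down lemma rests on uniqueness of the trace on a factor, by averaging over unitaries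
(`eq_mul_of_conj_invariant`), and on a Radon–Nikodym theorem for `τ` (`exists_eq_map_mul`). -/

namespace VonNeumannAlgebra

open Filter Topology

variable {H : Type*} [NormedAddCommGroup H] [InnerProductSpace ℂ H] [CompleteSpace H]

namespace FaithfulNormalTrace

variable {M N : VonNeumannAlgebra H} (τ : M.FaithfulNormalTrace)

/-! ### The vectors of `L²(M, τ)` coming from `M` -/

/-- The linear map `x ↦ vec x`. -/
noncomputable def vecLin : M.toStarSubalgebra →ₗ[ℂ] τ.L2 :=
  (UniformSpace.Completion.toComplL (𝕜 := ℂ) (E := τ.toPositiveLinearMap.PreGNS)).toLinearMap ∘ₗ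
    τ.toPositiveLinearMap.toPreGNS.toLinearMap

theorem vecLin_apply (x : M.toStarSubalgebra) : τ.vecLin x = τ.vec x := rfl

theorem vec_sub (x y : M.toStarSubalgebra) : τ.vec (x - y) = τ.vec x - τ.vec y :=
  τ.vecLin.map_sub x y

theorem vec_zero : τ.vec 0 = 0 := τ.vecLin.map_zero

theorem inner_vec (x y : M.toStarSubalgebra) :
    ⟪τ.vec x, τ.vec y⟫_ℂ = τ.toLinearMap (star x * y) :=
  UniformSpace.Completion.inner_coe _ _

theorem norm_vec_sq (x : M.toStarSubalgebra) :
    (‖τ.vec x‖ ^ 2 : ℝ) = (τ.toLinearMap (star x * x)).re := by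
  rw [← τ.inner_vec, ← inner_self_eq_norm_sq (𝕜 := ℂ)]; rfl

theorem map_star_mul_self (x : M.toStarSubalgebra) :
    τ.toLinearMap (star x * x) = ((‖τ.vec x‖ ^ 2 : ℝ) : ℂ) := by
  rw [← τ.inner_vec, inner_self_eq_norm_sq_to_K]; norm_cast

theorem map_nonneg {x : M.toStarSubalgebra} (hx : 0 ≤ x) : 0 ≤ τ.toLinearMap x :=
  τ.toPositiveLinearMap.map_nonneg hx

theorem map_re_mono {x y : M.toStarSubalgebra} (h : x ≤ y) :
    (τ.toLinearMap x).re ≤ (τ.toLinearMap y).re := by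
  have := τ.map_nonneg (sub_nonneg.2 h)
  rw [map_sub, Complex.nonneg_iff] at this
  simpa using this.1

theorem map_eq_re_of_nonneg {x : M.toStarSubalgebra} (hx : 0 ≤ x) :
    τ.toLinearMap x = ((τ.toLinearMap x).re : ℂ) :=
  Complex.ext rfl (by simpa using (Complex.nonneg_iff.1 (τ.map_nonneg hx)).2.symm)

theorem norm_vec_one : ‖τ.vec 1‖ = 1 := by
  have := τ.norm_vec_sq 1
  rw [star_one, one_mul, τ.map_one, Complex.one_re] at this
  exact (pow_eq_one_iff_of_nonneg (norm_nonneg _) two_ne_zero).1 this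

theorem denseRange_vec : DenseRange τ.vec :=
  (UniformSpace.Completion.denseRange_coe (α := τ.toPositiveLinearMap.PreGNS)).comp
    τ.toPositiveLinearMap.toPreGNS.surjective.denseRange (UniformSpace.Completion.continuous_coe _)

theorem vec_eq_zero {x : M.toStarSubalgebra} : τ.vec x = 0 ↔ x = 0 := by
  refine ⟨fun h => τ.faithful x ?_, fun h => h ▸ τ.vec_zero⟩
  rw [map_star_mul_self, h]; simp

theorem vec_injective : Function.Injective τ.vec := fun x y h => by
  rw [← sub_eq_zero, ← τ.vec_eq_zero, vec_sub, h, sub_self]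

theorem norm_vec_star (x : M.toStarSubalgebra) : ‖τ.vec (star x)‖ = ‖τ.vec x‖ := by
  rw [← sq_eq_sq₀ (norm_nonneg _) (norm_nonneg _), norm_vec_sq, norm_vec_sq, star_star,
    τ.map_mul_comm]

theorem norm_leftRep_le (x : M.toStarSubalgebra) : ‖τ.leftRep x‖ ≤ ‖x‖ :=
  NonUnitalStarAlgHom.norm_apply_le τ.leftRep x

theorem norm_vec_mul_le (x y : M.toStarSubalgebra) : ‖τ.vec (x * y)‖ ≤ ‖x‖ * ‖τ.vec y‖ := by
  rw [← leftRep_vec]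
  exact (τ.leftRep x).le_of_opNorm_le (τ.norm_leftRep_le x) _

/-- Traciality makes the adjoint isometric for `‖·‖₂`, which turns the bound for left multiplication
into one for right multiplication. -/
theorem norm_vec_mul_le' (x y : M.toStarSubalgebra) : ‖τ.vec (x * y)‖ ≤ ‖τ.vec x‖ * ‖y‖ := by
  rw [← norm_vec_star, star_mul, mul_comm, ← norm_star y, ← τ.norm_vec_star x]
  exact τ.norm_vec_mul_le _ _

theorem norm_vec_le (x : M.toStarSubalgebra) : ‖τ.vec x‖ ≤ ‖x‖ := by
  simpa [norm_vec_one] using τ.norm_vec_mul_le x 1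

theorem ext_vec {ξ η : τ.L2} (h : ∀ x, ⟪τ.vec x, ξ⟫_ℂ = ⟪τ.vec x, η⟫_ℂ) : ξ = η := by
  refine τ.denseRange_vec.eq_of_inner_left ℂ fun x => ?_
  rw [← inner_conj_symm, h, inner_conj_symm]

theorem clm_ext {F : Type*} [NormedAddCommGroup F] [NormedSpace ℂ F] {S T : τ.L2 →L[ℂ] F}
    (h : ∀ x, S (τ.vec x) = T (τ.vec x)) : S = T := by
  ext ξ
  exact congrFun (τ.denseRange_vec.equalizer S.continuous T.continuous (funext h)) ξ

/-! ### Right multiplication -/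

/-- The action of `M` on `L²(M, τ)` by right multiplication. -/
noncomputable def rightMul (a : M.toStarSubalgebra) : τ.L2 →L[ℂ] τ.L2 :=
  ((τ.toPositiveLinearMap.toPreGNS.toLinearMap ∘ₗ (LinearMap.mulRight ℂ a) ∘ₗ
    τ.toPositiveLinearMap.ofPreGNS.toLinearMap).mkContinuous ‖a‖ fun x => by
      have := τ.norm_vec_mul_le' (τ.toPositiveLinearMap.ofPreGNS x) a
      rw [mul_comm] at this
      unfold vec at this
      rwa [UniformSpace.Completion.norm_coe, UniformSpace.Completion.norm_coe] at this).completion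

theorem rightMul_vec (a x : M.toStarSubalgebra) : τ.rightMul a (τ.vec x) = τ.vec (x * a) := by
  simp [rightMul, vec]

theorem norm_rightMul_le (a : M.toStarSubalgebra) : ‖τ.rightMul a‖ ≤ ‖a‖ := by
  refine ContinuousLinearMap.opNorm_le_bound _ (norm_nonneg _) fun ξ => ?_
  refine τ.denseRange_vec.induction_on (p := fun ξ => ‖τ.rightMul a ξ‖ ≤ ‖a‖ * ‖ξ‖) ξ ?_ ?_
  · exact isClosed_le (by fun_prop) (by fun_prop)
  · intro x
    rw [rightMul_vec, mul_comm]
    exact τ.norm_vec_mul_le' x a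

theorem leftRep_rightMul (x a : M.toStarSubalgebra) :
    τ.leftRep x * τ.rightMul a = τ.rightMul a * τ.leftRep x :=
  τ.clm_ext fun y => by simp [rightMul_vec, leftRep_vec, mul_assoc]

end FaithfulNormalTrace

end VonNeumannAlgebra

namespace VonNeumannAlgebra

open Filter Topology

variable {H : Type*} [NormedAddCommGroup H] [InnerProductSpace ℂ H] [CompleteSpace H]

/-! ### Weak operator limits -/

/-- Bounded families of operators converge weakly along ultrafilters. -/
theorem exists_weak_limit_clm {ι : Type*} (U : Ultrafilter ι) (T : ι → H →L[ℂ] H) {C : ℝ}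
    (hT : ∀ i, ‖T i‖ ≤ C) :
    ∃ S : H →L[ℂ] H, ‖S‖ ≤ C ∧
      ∀ ξ η : H, Tendsto (fun i => ⟪η, T i ξ⟫_ℂ) U (𝓝 ⟪η, S ξ⟫_ℂ) := by
  obtain ⟨i₀⟩ : Nonempty ι := U.neBot.nonempty
  have hC : 0 ≤ C := (norm_nonneg _).trans (hT i₀)
  have hbd : ∀ ξ η i, ‖⟪T i ξ, η⟫_ℂ‖ ≤ C * ‖ξ‖ * ‖η‖ := fun ξ η i =>
    (norm_inner_le_norm _ _).trans (by gcongr; exact (T i).le_of_opNorm_le (hT i) ξ)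
  -- Each matrix coefficient stays in a compact disc, so it converges along `U`. The limits form a
  -- bounded sesquilinear form, which an operator represents.
  have hlim : ∀ ξ η, ∃ c ∈ Metric.closedBall (0 : ℂ) (C * ‖ξ‖ * ‖η‖),
      Tendsto (fun i => ⟪T i ξ, η⟫_ℂ) U (𝓝 c) := fun ξ η =>
    (isCompact_closedBall (0 : ℂ) _).ultrafilter_le_nhds
      (U.map fun i => ⟪T i ξ, η⟫_ℂ) (by
        rw [le_principal_iff, Ultrafilter.coe_map, mem_map]
        exact Eventually.of_forall fun i => mem_closedBall_zero_iff.2 (hbd ξ η i))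
  choose B hB hlim using hlim
  let B' : H →L⋆[ℂ] H →L[ℂ] ℂ := LinearMap.mkContinuous₂
    (LinearMap.mk₂'ₛₗ (starRingEnd ℂ) (RingHom.id ℂ) B
      (fun a b c => tendsto_nhds_unique (hlim _ _)
        (((hlim a c).add (hlim b c)).congr fun i => by rw [map_add, inner_add_left]))
      (fun r a c => tendsto_nhds_unique (hlim _ _)
        (((hlim a c).const_mul _).congr fun i => by rw [map_smul, inner_smul_left]))
      (fun a b c => tendsto_nhds_unique (hlim _ _)
        (((hlim a b).add (hlim a c)).congr fun i => by rw [inner_add_right]))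
      (fun r a c => tendsto_nhds_unique (hlim _ _)
        (((hlim a c).const_mul _).congr fun i => by
          rw [inner_smul_right]; rfl))) C
    (fun a b => mem_closedBall_zero_iff.1 (hB a b))
  have hB' : ∀ ξ η, ⟪InnerProductSpace.continuousLinearMapOfBilin B' ξ, η⟫_ℂ = B ξ η :=
      fun ξ η => by
    rw [InnerProductSpace.continuousLinearMapOfBilin_apply]; rfl
  refine ⟨InnerProductSpace.continuousLinearMapOfBilin B', ?_, fun ξ η => ?_⟩
  · refine ContinuousLinearMap.opNorm_le_bound _ hC fun ξ => ?_
    set v := InnerProductSpace.continuousLinearMapOfBilin B' ξ with hv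
    have h1 : ‖v‖ * ‖v‖ ≤ C * ‖ξ‖ * ‖v‖ := by
      have h2 := mem_closedBall_zero_iff.1 (hB ξ v)
      rw [← hB', ← hv, inner_self_eq_norm_sq_to_K, sq] at h2
      simpa using h2
    rcases (norm_nonneg v).eq_or_lt with h | h
    · rw [← h]; positivity
    · exact le_of_mul_le_mul_right h1 h
  · have := (Complex.continuous_conj.tendsto _).comp (hlim ξ η)
    rw [← hB'] at this
    simpa only [Function.comp_def, inner_conj_symm] using this

/-- Bounded families in a von Neumann algebra converge weakly along ultrafilters. -/
theorem exists_weak_limit (M : VonNeumannAlgebra H) {ι : Type*} (U : Ultrafilter ι)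
    (x : ι → M.toStarSubalgebra) {C : ℝ} (hx : ∀ i, ‖x i‖ ≤ C) :
    ∃ y : M.toStarSubalgebra, ‖y‖ ≤ C ∧ ∀ ξ η : H,
      Tendsto (fun i => ⟪η, (x i : H →L[ℂ] H) ξ⟫_ℂ) U (𝓝 ⟪η, (y : H →L[ℂ] H) ξ⟫_ℂ) := by
  obtain ⟨S, hS, hlim⟩ := exists_weak_limit_clm U (fun i => (x i : H →L[ℂ] H)) hx
  have hmem : S ∈ M := by
    rw [← M.commutant_commutant, mem_commutant_iff]
    intro g hg
    rw [mem_commutant_iff] at hg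
    ext ξ
    refine ext_inner_left ℂ fun η => ?_
    refine tendsto_nhds_unique (l := (U : Filter ι))
      (f := fun i => ⟪η, (g * (x i : H →L[ℂ] H)) ξ⟫_ℂ) ?_ ?_
    · have := hlim ξ (ContinuousLinearMap.adjoint g η)
      simpa only [ContinuousLinearMap.adjoint_inner_left] using! this
    · have := hlim (g ξ) η
      refine this.congr fun i => ?_
      rw [← hg _ (x i).2]; rfl
  exact ⟨⟨S, hmem⟩, hS, hlim⟩

/-- The closure of the image of a nonempty convex set in a Hilbert space has a unique element of
minimal norm. -/
theorem exists_minimal_norm {A E : Type*} [AddCommGroup A] [Module ℂ A] [Module ℝ A]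
    [IsScalarTower ℝ ℂ A] [NormedAddCommGroup E] [InnerProductSpace ℂ E] [CompleteSpace E]
    (f : A →ₗ[ℂ] E) {S : Set A} (hS : Convex ℝ S) (hne : S.Nonempty) :
    ∃ ξ ∈ closure (f '' S), ∀ ζ ∈ closure (f '' S), ‖ζ‖ ≤ ‖ξ‖ → ζ = ξ := by
  let : InnerProductSpace ℝ E := InnerProductSpace.rclikeToReal ℂ E
  have hconv : Convex ℝ (closure (f '' S)) := (hS.linear_image (f.restrictScalars ℝ)).closure
  obtain ⟨ξ, hξ, hmin⟩ := exists_norm_eq_iInf_of_complete_convex (hne.image f).closure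
    isClosed_closure.isComplete hconv 0
  rw [norm_eq_iInf_iff_real_inner_le_zero hconv hξ] at hmin
  refine ⟨ξ, hξ, fun ζ hζ hle => ?_⟩
  have h3 := hmin _ hζ
  have h5 : ‖ζ - ξ‖ ^ 2 ≤ 0 := by
    rw [@norm_sub_sq_real]
    rw [zero_sub, inner_neg_left, inner_sub_right, real_inner_self_eq_norm_sq] at h3
    rw [real_inner_comm]
    nlinarith [norm_nonneg ζ]
  exact sub_eq_zero.1 (by simpa using h5)

/-! ### Normality: the `L²`-norm and the operator topologies on balls -/

namespace FaithfulNormalTrace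

variable {M N : VonNeumannAlgebra H} (τ : M.FaithfulNormalTrace)

/-- A normal trace is weakly continuous on bounded sets. -/
theorem tendsto_of_weak {ι : Type*} {l : Filter ι} {x : ι → M.toStarSubalgebra}
    {y : M.toStarSubalgebra} {C : ℝ} (hx : ∀ i, ‖x i‖ ≤ C)
    (h : ∀ ξ η : H, Tendsto (fun i => ⟪η, (x i : H →L[ℂ] H) ξ⟫_ℂ) l
      (𝓝 ⟪η, (y : H →L[ℂ] H) ξ⟫_ℂ)) :
    Tendsto (fun i => τ.toLinearMap (x i)) l (𝓝 (τ.toLinearMap y)) := by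
  obtain ⟨ξ, η, hξ, hη, hs⟩ := τ.normal
  simp only [← (hs _).tsum_eq]
  refine tendsto_tsum_of_dominated_convergence (bound := fun n => |C| * (‖ξ n‖ ^ 2 + ‖η n‖ ^ 2))
    ((hξ.add hη).mul_left _) (fun n => h (ξ n) (η n)) (Eventually.of_forall fun i n => ?_)
  calc ‖⟪η n, (x i : H →L[ℂ] H) (ξ n)⟫_ℂ‖ ≤ ‖η n‖ * ‖(x i : H →L[ℂ] H) (ξ n)‖ :=
        norm_inner_le_norm _ _
    _ ≤ ‖η n‖ * (|C| * ‖ξ n‖) := by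
        gcongr
        exact ContinuousLinearMap.le_of_opNorm_le _ ((hx i).trans (le_abs_self C)) _
    _ = |C| * (‖ξ n‖ * ‖η n‖) := by ring
    _ ≤ _ := by
        gcongr
        nlinarith [sq_nonneg (‖ξ n‖ - ‖η n‖), sq_nonneg (‖ξ n‖), sq_nonneg (‖η n‖)]

/-- The pairing of `vec a` with `vec (x i)` is `τ (star a * x i)`, which converges by normality; so
weak operator limits and `L²`-limits of bounded families agree. -/
theorem vec_eq_of_tendsto {ι : Type*} {l : Filter ι} [l.NeBot] {x : ι → M.toStarSubalgebra}
    {y : M.toStarSubalgebra} {C : ℝ} (hx : ∀ i, ‖x i‖ ≤ C)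
    (h : ∀ ξ η : H, Tendsto (fun i => ⟪η, (x i : H →L[ℂ] H) ξ⟫_ℂ) l
      (𝓝 ⟪η, (y : H →L[ℂ] H) ξ⟫_ℂ)) {ζ : τ.L2}
    (hζ : Tendsto (fun i => τ.vec (x i)) l (𝓝 ζ)) : τ.vec y = ζ := by
  refine τ.ext_vec fun a => ?_
  refine tendsto_nhds_unique (f := fun i => ⟪τ.vec a, τ.vec (x i)⟫_ℂ) (l := l) ?_
    (tendsto_const_nhds.inner hζ)
  simp only [inner_vec]
  refine τ.tendsto_of_weak (C := ‖star a‖ * C) (fun i => ?_) fun ξ η => ?_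
  · exact (norm_mul_le _ _).trans (by gcongr; exact hx i)
  · have := h ξ ((a : H →L[ℂ] H) η)
    simpa only [← ContinuousLinearMap.adjoint_inner_right] using! this

/-- Balls of `M` are complete in `L²(M, τ)`. -/
theorem exists_vec_eq_of_mem_closure {C : ℝ} {ζ : τ.L2}
    (hζ : ζ ∈ closure (τ.vec '' Metric.closedBall 0 C)) :
    ∃ x : M.toStarSubalgebra, ‖x‖ ≤ C ∧ τ.vec x = ζ := by
  obtain ⟨v, hv, hlim⟩ := mem_closure_iff_seq_limit.1 hζ
  choose x hx hxv using hv
  have hx' : ∀ n, ‖x n‖ ≤ C := fun n => mem_closedBall_zero_iff.1 (hx n)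
  obtain ⟨y, hy, hlim'⟩ := M.exists_weak_limit (hyperfilter ℕ) x hx'
  refine ⟨y, hy, τ.vec_eq_of_tendsto hx' hlim' ?_⟩
  simp only [hxv]
  exact hlim.mono_left Nat.hyperfilter_le_atTop

/-- On bounded sets, convergence in `L²(M, τ)` implies strong convergence. -/
theorem tendsto_apply_of_tendsto_vec {ι : Type*} {l : Filter ι} {x : ι → M.toStarSubalgebra}
    {C : ℝ} (hx : ∀ i, ‖x i‖ ≤ C) (h : Tendsto (fun i => τ.vec (x i)) l (𝓝 0)) (ξ : H) :
    Tendsto (fun i => (x i : H →L[ℂ] H) ξ) l (𝓝 0) := by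
  rw [tendsto_iff_ultrafilter]
  intro U hU
  have hC : ∀ i, ‖star (x i) * x i‖ ≤ C * C := fun i =>
    (norm_mul_le _ _).trans (by
      rw [norm_star]
      exact mul_le_mul (hx i) (hx i) (norm_nonneg _) ((norm_nonneg _).trans (hx i)))
  -- `star (x i) * x i` tends to zero in `L²`, so faithfulness forces its weak limit `y` to vanish.
  -- Its coefficients at `ξ` are the numbers `‖x i ξ‖ ^ 2`.
  obtain ⟨y, -, hy⟩ := M.exists_weak_limit U (fun i => star (x i) * x i) hC
  have h0 : τ.vec y = 0 := by
    refine τ.vec_eq_of_tendsto hC hy ?_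
    refine squeeze_zero_norm (a := fun i => C * ‖τ.vec (x i)‖) (fun i => ?_) ?_
    · refine (τ.norm_vec_mul_le _ _).trans ?_
      rw [norm_star]
      gcongr
      exact hx i
    · simpa using (h.mono_left hU).norm.const_mul C
  have h1 := hy ξ ξ
  rw [τ.vec_eq_zero.1 h0] at h1
  have h2 : Tendsto (fun i => ‖(x i : H →L[ℂ] H) ξ‖ ^ 2) U (𝓝 0) := by
    have h3 := h1.norm
    simp only [ZeroMemClass.coe_zero, _root_.zero_apply, inner_zero_right,
      norm_zero] at h3
    refine h3.congr fun i => ?_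
    change ‖⟪ξ, ContinuousLinearMap.adjoint (x i : H →L[ℂ] H) ((x i : H →L[ℂ] H) ξ)⟫_ℂ‖ = _
    rw [ContinuousLinearMap.adjoint_inner_right, inner_self_eq_norm_sq_to_K]
    simp
  rw [tendsto_zero_iff_norm_tendsto_zero]
  have h4 := (Real.continuous_sqrt.tendsto 0).comp h2
  simpa [Function.comp_def] using h4

/-! ### Averaging over unitaries and uniqueness of the trace -/

theorem mem_unitary_norm_le {u : M.toStarSubalgebra} (hu : u ∈ unitary M.toStarSubalgebra) :
    ‖u‖ ≤ 1 := by
  have h : ‖u‖ * ‖u‖ = ‖star u * u‖ := CStarRing.norm_star_mul_self.symm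
  rw [Unitary.star_mul_self_of_mem hu] at h
  have h1 : ‖(1 : M.toStarSubalgebra)‖ ≤ 1 := ContinuousLinearMap.norm_id_le
  nlinarith [norm_nonneg u]

/-- The convex hull of the unitary orbit of `x`. -/
def orbitHull (x : M.toStarSubalgebra) : Set M.toStarSubalgebra :=
  convexHull ℝ {y | ∃ u ∈ unitary M.toStarSubalgebra, y = u * x * star u}

theorem orbitHull_subset_closedBall (x : M.toStarSubalgebra) :
    orbitHull x ⊆ Metric.closedBall 0 ‖x‖ := by
  refine convexHull_min ?_ (convex_closedBall _ _)
  rintro _ ⟨u, hu, rfl⟩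
  rw [mem_closedBall_zero_iff]
  have := mem_unitary_norm_le hu
  calc ‖u * x * star u‖ ≤ ‖u‖ * ‖x‖ * ‖star u‖ := norm_mul₃_le
    _ ≤ 1 * ‖x‖ * 1 := by rw [norm_star]; gcongr
    _ = ‖x‖ := by ring

theorem map_eq_of_mem_orbitHull (φ : M.toStarSubalgebra →ₗ[ℂ] ℂ)
    (hφ : ∀ u ∈ unitary M.toStarSubalgebra, ∀ x, φ (u * x * star u) = φ x)
    {x y : M.toStarSubalgebra} (hy : y ∈ orbitHull x) : φ y = φ x := by
  have hconv : Convex ℝ ((φ.restrictScalars ℝ) ⁻¹' {φ x}) :=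
    (convex_singleton (φ x)).linear_preimage _
  refine convexHull_min ?_ hconv hy
  rintro _ ⟨u, hu, rfl⟩
  exact hφ u hu x

theorem conj_mem_orbitHull {x y u : M.toStarSubalgebra} (hu : u ∈ unitary M.toStarSubalgebra)
    (hy : y ∈ orbitHull x) : u * y * star u ∈ orbitHull x := by
  let f : M.toStarSubalgebra →ₗ[ℂ] M.toStarSubalgebra :=
    LinearMap.mulRight ℂ (star u) ∘ₗ LinearMap.mulLeft ℂ u
  have h1 : (f.restrictScalars ℝ) y ∈ (f.restrictScalars ℝ) '' orbitHull x := ⟨y, hy, rfl⟩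
  rw [orbitHull, LinearMap.image_convexHull] at h1
  refine convexHull_mono ?_ h1
  rintro _ ⟨_, ⟨v, hv, rfl⟩, rfl⟩
  refine ⟨u * v, mul_mem hu hv, ?_⟩
  change u * (v * x * star v) * star u = _
  simp only [star_mul, mul_assoc]

theorem map_unitary_conj {u : M.toStarSubalgebra} (hu : u ∈ unitary M.toStarSubalgebra)
    (x : M.toStarSubalgebra) : τ.toLinearMap (u * x * star u) = τ.toLinearMap x := by
  rw [τ.map_mul_comm, ← mul_assoc, Unitary.star_mul_self_of_mem hu, one_mul]

/-- In a factor, the trace of `x` is an `L²`-limit of unitary averages of `x`. -/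
theorem map_smul_one_mem_closure_orbitHull
    (hM : ∀ x ∈ M, x ∈ M.commutant → ∃ c : ℂ, x = c • (1 : H →L[ℂ] H))
    (x : M.toStarSubalgebra) :
    τ.vec (τ.toLinearMap x • 1) ∈ closure (τ.vec '' orbitHull x) := by
  set D : Set τ.L2 := closure (τ.vec '' orbitHull x) with hD
  have hne : (orbitHull x).Nonempty := ⟨x, subset_convexHull _ _ ⟨1, one_mem _, by simp⟩⟩
  obtain ⟨ξ, hξ, hmin⟩ := exists_minimal_norm τ.vecLin (convex_convexHull ℝ _) hne
  obtain ⟨c, -, rfl⟩ := τ.exists_vec_eq_of_mem_closure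
    (closure_mono (Set.image_mono (orbitHull_subset_closedBall x)) hξ)
  -- Conjugation by `u` preserves the closed hull and does not increase `‖·‖₂`, so it fixes the
  -- unique element of minimal norm.
  have hcu : ∀ u ∈ unitary M.toStarSubalgebra, u * c = c * u := by
    intro u hu
    have hmaps : Set.MapsTo (τ.leftRep u * τ.rightMul (star u)) (τ.vec '' orbitHull x)
        (τ.vec '' orbitHull x) := by
      rintro _ ⟨y, hy, rfl⟩
      refine ⟨u * y * star u, conj_mem_orbitHull hu hy, ?_⟩
      simp [rightMul_vec, leftRep_vec, mul_assoc]
    have h1 := hmaps.closure (τ.leftRep u * τ.rightMul (star u)).continuous hξ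
    have h2 : (τ.leftRep u * τ.rightMul (star u)) (τ.vec c) = τ.vec (u * c * star u) := by
      simp [rightMul_vec, leftRep_vec, mul_assoc]
    rw [h2] at h1
    have h3 := hmin _ h1
    have h4 : ‖τ.vec (u * c * star u)‖ ≤ ‖τ.vec c‖ := by
      have hu' := mem_unitary_norm_le hu
      refine (τ.norm_vec_mul_le' _ _).trans ?_
      rw [norm_star]
      refine (mul_le_of_le_one_right (norm_nonneg _) hu').trans ?_
      exact (τ.norm_vec_mul_le _ _).trans (mul_le_of_le_one_left (norm_nonneg _) hu')
    have h6 : u * c * star u = c := τ.vec_injective (h3 h4)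
    calc u * c = u * c * (star u * u) := by rw [Unitary.star_mul_self_of_mem hu, mul_one]
      _ = u * c * star u * u := by simp only [mul_assoc]
      _ = c * u := by rw [h6]
  have hcomm : ∀ a : M.toStarSubalgebra, a * c = c * a := by
    intro a
    have ha : a ∈ Submodule.span ℂ (unitary M.toStarSubalgebra : Set M.toStarSubalgebra) := by
      rw [CStarAlgebra.span_unitary]; trivial
    induction ha using Submodule.span_induction with
    | mem u hu => exact hcu u hu
    | zero => simp
    | add a b _ _ ha hb => rw [add_mul, mul_add, ha, hb]
    | smul r a _ ha => rw [smul_mul_assoc, mul_smul_comm, ha]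
  obtain ⟨r, hr⟩ := hM c c.2 (mem_commutant_iff.2 fun g hg =>
    congrArg Subtype.val (hcomm ⟨g, hg⟩))
  have hr' : c = r • 1 := Subtype.ext hr
  -- The trace is constant on the hull and `L²`-continuous; this identifies the scalar `r`.
  have hτ : ∀ ζ ∈ D, ⟪τ.vec 1, ζ⟫_ℂ = τ.toLinearMap x := by
    have hcl : IsClosed {ζ : τ.L2 | ⟪τ.vec 1, ζ⟫_ℂ = τ.toLinearMap x} :=
      isClosed_eq (by fun_prop) (by fun_prop)
    refine fun ζ hζ => closure_minimal ?_ hcl hζ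
    rintro _ ⟨y, hy, rfl⟩
    change ⟪_, _⟫_ℂ = _
    rw [inner_vec, star_one, one_mul]
    exact map_eq_of_mem_orbitHull _ (fun u hu => τ.map_unitary_conj hu) hy
  have h7 := hτ _ hξ
  rw [inner_vec, star_one, one_mul, hr', map_smul, τ.map_one, smul_eq_mul, mul_one] at h7
  rw [← h7, ← hr']
  exact hξ

/-- Uniqueness of the trace on a factor. -/
theorem eq_mul_of_conj_invariant
    (hM : ∀ x ∈ M, x ∈ M.commutant → ∃ c : ℂ, x = c • (1 : H →L[ℂ] H))
    (φ : M.toStarSubalgebra →ₗ[ℂ] ℂ)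
    (hφ : ∀ u ∈ unitary M.toStarSubalgebra, ∀ x, φ (u * x * star u) = φ x)
    (hcont : ∀ (c : ℕ → M.toStarSubalgebra) (y : M.toStarSubalgebra) (C : ℝ), (∀ n, ‖c n‖ ≤ C) →
      Tendsto (fun n => τ.vec (c n)) atTop (𝓝 (τ.vec y)) →
        Tendsto (fun n => φ (c n)) atTop (𝓝 (φ y))) (x : M.toStarSubalgebra) :
    φ x = τ.toLinearMap x * φ 1 := by
  obtain ⟨v, hv, hlim⟩ := mem_closure_iff_seq_limit.1 (τ.map_smul_one_mem_closure_orbitHull hM x)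
  choose c hc hcv using hv
  have h1 := hcont c _ ‖x‖
    (fun n => mem_closedBall_zero_iff.1 (orbitHull_subset_closedBall x (hc n)))
    (by simpa only [hcv] using hlim)
  simp only [fun n => map_eq_of_mem_orbitHull φ hφ (hc n)] at h1
  rw [tendsto_nhds_unique tendsto_const_nhds h1, map_smul, smul_eq_mul]

end FaithfulNormalTrace

end VonNeumannAlgebra

/-! ### Functional calculus and a Radon–Nikodym theorem -/

namespace VonNeumannAlgebra

open Filter Topology

section FunctionalCalculus

variable {A : Type*} [CStarAlgebra A] [PartialOrder A] [StarOrderedRing A]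

/-- An approximate polar decomposition: `u` is almost the partial isometry of `a`, and
`a = b * c` is almost the factorization into square roots of `|a|`. -/
theorem exists_approx_polar (a : A) {δ : ℝ} (hδ : 0 < δ) :
    ∃ u b c : A, ‖u‖ ≤ 1 ∧ a = b * c ∧ star b * b ≤ star a * u ∧
      star c * c ≤ star a * u + (2 * δ) • 1 := by
  set h : A := star a * a with hh
  have hsa : IsSelfAdjoint h := IsSelfAdjoint.star_mul_self a
  have hsp : ∀ t ∈ spectrum ℝ h, 0 ≤ t := fun t ht =>
    spectrum_nonneg_of_nonneg (star_mul_self_nonneg a) ht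
  have hpos : ∀ t : ℝ, 0 < √t + δ := fun t => by positivity
  have hpos' : ∀ t : ℝ, 0 < √(√t + δ) := fun t => Real.sqrt_pos.2 (hpos t)
  have cs : Continuous fun t : ℝ => √(√t + δ) := by fun_prop
  have cg : Continuous fun t : ℝ => (√t + δ)⁻¹ :=
    (Real.continuous_sqrt.add continuous_const).inv₀ fun t => (hpos t).ne'
  have cw : Continuous fun t : ℝ => (√(√t + δ))⁻¹ := cs.inv₀ fun t => (hpos' t).ne'
  have ctg : Continuous fun t : ℝ => t * (√t + δ)⁻¹ := continuous_id.mul cg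
  have ctw : Continuous fun t : ℝ => t * (√(√t + δ))⁻¹ := continuous_id.mul cw
  have hu : star a * (a * cfc (fun t : ℝ => (√t + δ)⁻¹) h) =
      cfc (fun t : ℝ => t * (√t + δ)⁻¹) h := by
    rw [← mul_assoc, cfc_mul (fun t : ℝ => t) _ h continuousOn_id cg.continuousOn, cfc_id' ℝ h]
  -- With `|a| = √h`, the witnesses are `u = a (|a| + δ)⁻¹`, `b = a (|a| + δ)^(-1/2)` and `c = (|a|
  -- + δ)^(1/2)`. The shift by `δ` replaces invertibility of `|a|`, and costs `2δ` because `(√t +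
  -- δ)² ≤ t + 2δ(√t + δ)`.
  refine ⟨a * cfc (fun t : ℝ => (√t + δ)⁻¹) h, a * cfc (fun t : ℝ => (√(√t + δ))⁻¹) h,
    cfc (fun t : ℝ => √(√t + δ)) h, ?_, ?_, ?_, ?_⟩
  · have h1 : star (a * cfc (fun t : ℝ => (√t + δ)⁻¹) h) * (a * cfc (fun t : ℝ => (√t + δ)⁻¹) h) =
        cfc (fun t : ℝ => (√t + δ)⁻¹ * (t * (√t + δ)⁻¹)) h := by
      rw [star_mul, mul_assoc, hu, (cfc_predicate (R := ℝ) _ h : IsSelfAdjoint _).star_eq,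
        ← cfc_mul _ _ h cg.continuousOn ctg.continuousOn]
    have h2 : ‖cfc (fun t : ℝ => (√t + δ)⁻¹ * (t * (√t + δ)⁻¹)) h‖ ≤ 1 := by
      refine norm_cfc_le zero_le_one fun t ht => ?_
      have h0 := hsp t ht
      rw [Real.norm_of_nonneg (by positivity)]
      have h3 : t ≤ (√t + δ) * (√t + δ) := by
        nlinarith [Real.mul_self_sqrt h0, Real.sqrt_nonneg t]
      rw [← mul_assoc, mul_comm _ t, mul_assoc, ← mul_inv]
      exact mul_inv_le_one_of_le₀ h3 (by positivity)
    rw [← h1, CStarRing.norm_star_mul_self] at h2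
    nlinarith [norm_nonneg (a * cfc (fun t : ℝ => (√t + δ)⁻¹) h)]
  · rw [mul_assoc, ← cfc_mul _ _ h cw.continuousOn cs.continuousOn]
    simp only [inv_mul_cancel₀ (hpos' _).ne']
    rw [cfc_const_one ℝ h, mul_one]
  · refine le_of_eq ?_
    rw [hu, star_mul, mul_assoc, ← mul_assoc (star a), ← hh,
      (cfc_predicate (R := ℝ) _ h : IsSelfAdjoint _).star_eq]
    nth_rewrite 2 [← cfc_id' ℝ h]
    rw [← cfc_mul (fun t : ℝ => t) _ h continuousOn_id cw.continuousOn,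
      ← cfc_mul _ _ h cw.continuousOn ctw.continuousOn]
    congr 1
    ext t
    have h1 := Real.mul_self_sqrt (hpos t).le
    rw [mul_left_comm, ← mul_inv, h1]
  · rw [hu, (cfc_predicate (R := ℝ) _ h : IsSelfAdjoint _).star_eq,
      ← cfc_mul _ _ h cs.continuousOn cs.continuousOn]
    simp only [Real.mul_self_sqrt (hpos _).le]
    rw [← Algebra.algebraMap_eq_smul_one, ← cfc_add_const (2 * δ) _ h ctg.continuousOn]
    refine cfc_mono (fun t ht => ?_) (by fun_prop)
      (ctg.add continuous_const).continuousOn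
    have h0 := hsp t ht
    have h1 := Real.mul_self_sqrt h0
    have h2 : (√t + δ) * (√t + δ) ≤ t + 2 * δ * (√t + δ) := by nlinarith
    have h3 : t * (√t + δ)⁻¹ + 2 * δ = (t + 2 * δ * (√t + δ)) * (√t + δ)⁻¹ := by
      rw [add_mul, mul_assoc (2 * δ), mul_inv_cancel₀ (hpos t).ne', mul_one]
    rw [h3, le_mul_inv_iff₀ (hpos t)]
    exact h2

/-- An approximate inverse square root of a positive element. -/
theorem exists_approx_inv_sqrt {h : A} (hh : 0 ≤ h) {δ : ℝ} (hδ : 0 < δ) :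
    ∃ g : A, star g = g ∧ ‖g * h * g‖ ≤ 1 ∧
      ‖(1 - h * g * g) * h * star (1 - h * g * g)‖ ≤ δ := by
  have hsa : IsSelfAdjoint h := IsSelfAdjoint.of_nonneg hh
  have hsp : ∀ t ∈ spectrum ℝ h, 0 ≤ t := fun t ht => spectrum_nonneg_of_nonneg hh ht
  have hpos : ∀ t : ℝ, 0 < |t| + δ := fun t => by positivity
  have hpos' : ∀ t : ℝ, 0 < √(|t| + δ) := fun t => Real.sqrt_pos.2 (hpos t)
  have cg : Continuous fun t : ℝ => (√(|t| + δ))⁻¹ :=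
    Continuous.inv₀ (by fun_prop) fun t => (hpos' t).ne'
  have ctg : Continuous fun t : ℝ => t * (√(|t| + δ))⁻¹ := continuous_id.mul cg
  have cgt : Continuous fun t : ℝ => (√(|t| + δ))⁻¹ * t := cg.mul continuous_id
  have ctgg : Continuous fun t : ℝ => t * (√(|t| + δ))⁻¹ * (√(|t| + δ))⁻¹ := ctg.mul cg
  have ck : Continuous fun t : ℝ => 1 - t * (√(|t| + δ))⁻¹ * (√(|t| + δ))⁻¹ :=
    continuous_const.sub ctgg
  -- `g = (h + δ)^(-1/2)`; the absolute value only makes the function continuous on all of `ℝ`. Then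
  -- `1 - h g² = δ (h + δ)⁻¹`.
  set g : A := cfc (fun t : ℝ => (√(|t| + δ))⁻¹) h with hg
  have hk : 1 - h * g * g = cfc (fun t : ℝ => 1 - t * (√(|t| + δ))⁻¹ * (√(|t| + δ))⁻¹) h := by
    rw [cfc_sub (fun _ => (1 : ℝ)) _ h continuousOn_const ctgg.continuousOn,
      cfc_const_one ℝ h, cfc_mul _ _ h ctg.continuousOn cg.continuousOn,
      cfc_mul (fun t : ℝ => t) _ h continuousOn_id cg.continuousOn, cfc_id' ℝ h]
  have hsq : ∀ t : ℝ, (√(|t| + δ))⁻¹ * (√(|t| + δ))⁻¹ = (|t| + δ)⁻¹ := fun t => by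
    rw [← mul_inv, Real.mul_self_sqrt (hpos t).le]
  have hgs : star g = g := (cfc_predicate (R := ℝ) _ h : IsSelfAdjoint _)
  refine ⟨g, hgs, ?_, ?_⟩
  · have h1 : g * h * g = cfc (fun t : ℝ => (√(|t| + δ))⁻¹ * t * (√(|t| + δ))⁻¹) h := by
      rw [cfc_mul _ _ h cgt.continuousOn cg.continuousOn,
        cfc_mul _ (fun t : ℝ => t) h cg.continuousOn continuousOn_id, cfc_id' ℝ h]
    rw [h1]
    refine norm_cfc_le zero_le_one fun t ht => ?_
    have h0 := hsp t ht
    rw [Real.norm_of_nonneg (by positivity), mul_comm _ t, mul_assoc, hsq]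
    exact mul_inv_le_one_of_le₀ (by rw [abs_of_nonneg h0]; linarith) (hpos t).le
  · rw [hk, (cfc_predicate (R := ℝ) _ h : IsSelfAdjoint _).star_eq]
    set k : ℝ → ℝ := fun t => 1 - t * (√(|t| + δ))⁻¹ * (√(|t| + δ))⁻¹ with hkdef
    have ckt : Continuous fun t : ℝ => k t * t := ck.mul continuous_id
    have h1 : cfc k h * h * cfc k h = cfc (fun t : ℝ => k t * t * k t) h := by
      rw [cfc_mul _ _ h ckt.continuousOn ck.continuousOn,
        cfc_mul _ (fun t : ℝ => t) h ck.continuousOn continuousOn_id, cfc_id' ℝ h]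
    rw [h1]
    refine norm_cfc_le hδ.le fun t ht => ?_
    have h0 := hsp t ht
    have hk' : k t = δ * (t + δ)⁻¹ := by
      have : (t + δ) ≠ 0 := by positivity
      simp only [hkdef]
      rw [mul_assoc, hsq, abs_of_nonneg h0]
      field_simp
      ring
    rw [hk', Real.norm_of_nonneg (by positivity)]
    have hp : 0 < t + δ := by positivity
    have : δ * (t + δ)⁻¹ * t * (δ * (t + δ)⁻¹) = δ * ((δ * t) / ((t + δ) * (t + δ))) := by
      field_simp
    rw [this]
    refine mul_le_of_le_one_right hδ.le ((div_le_one (by positivity)).2 ?_)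
    nlinarith

end FunctionalCalculus

/-- A point outside the closure of the image of a convex set is separated from it. -/
theorem exists_separating_vector {A E : Type*} [AddCommGroup A] [Module ℂ A] [Module ℝ A]
    [IsScalarTower ℝ ℂ A] [NormedAddCommGroup E] [InnerProductSpace ℂ E] [CompleteSpace E]
    (f : A →ₗ[ℂ] E) {S : Set A} (hS : Convex ℝ S) (hne : S.Nonempty) {ζ : E}
    (hζ : ζ ∉ closure (f '' S)) :
    ∃ (η : E) (r : ℝ), (∀ x ∈ S, (⟪η, f x⟫_ℂ).re ≤ r) ∧ r < (⟪η, ζ⟫_ℂ).re := by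
  let : InnerProductSpace ℝ E := InnerProductSpace.rclikeToReal ℂ E
  have hconv : Convex ℝ (closure (f '' S)) := (hS.linear_image (f.restrictScalars ℝ)).closure
  obtain ⟨ξ, hξ, hmin⟩ := exists_norm_eq_iInf_of_complete_convex (hne.image f).closure
    isClosed_closure.isComplete hconv ζ
  rw [norm_eq_iInf_iff_real_inner_le_zero hconv hξ] at hmin
  refine ⟨ζ - ξ, (⟪ζ - ξ, ξ⟫_ℂ).re, fun x hx => ?_, ?_⟩
  · have h1 : (⟪ζ - ξ, f x - ξ⟫_ℂ).re ≤ 0 := hmin _ (subset_closure ⟨x, hx, rfl⟩)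
    rw [inner_sub_right, Complex.sub_re] at h1
    linarith
  · have h1 : 0 < ‖ζ - ξ‖ := norm_pos_iff.2 (sub_ne_zero.2 fun h => hζ (h ▸ hξ))
    have h2 : (⟪ζ - ξ, ζ - ξ⟫_ℂ).re = ‖ζ - ξ‖ ^ 2 := inner_self_eq_norm_sq (𝕜 := ℂ) _
    rw [inner_sub_right, Complex.sub_re] at h2
    nlinarith

variable {H : Type*} [NormedAddCommGroup H] [InnerProductSpace ℂ H] [CompleteSpace H]

namespace FaithfulNormalTrace

variable {M N : VonNeumannAlgebra H} (τ : M.FaithfulNormalTrace)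

/-- A linear functional bounded in `‖·‖₂` is given by a vector of `L²(M, τ)`. -/
theorem exists_vector_of_bounded (φ : M.toStarSubalgebra →ₗ[ℂ] ℂ) {C : ℝ}
    (hφ : ∀ a, ‖φ a‖ ≤ C * ‖τ.vec a‖) : ∃ ζ : τ.L2, ∀ y, ⟪ζ, τ.vec y⟫_ℂ = φ y := by
  let φ₀ : τ.toPositiveLinearMap.PreGNS →L[ℂ] ℂ :=
    (φ ∘ₗ τ.toPositiveLinearMap.ofPreGNS.toLinearMap).mkContinuous C fun a => by
      have := hφ (τ.toPositiveLinearMap.ofPreGNS a)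
      unfold vec at this
      rwa [UniformSpace.Completion.norm_coe] at this
  let Φ : τ.L2 →L[ℂ] ℂ := φ₀.extend UniformSpace.Completion.toComplL
  refine ⟨(InnerProductSpace.toDual ℂ τ.L2).symm Φ, fun y => ?_⟩
  rw [InnerProductSpace.toDual_symm_apply]
  exact φ₀.extend_eq UniformSpace.Completion.denseRange_coe
    (UniformSpace.Completion.isUniformInducing_coe _) (τ.toPositiveLinearMap.toPreGNS y)

/-- A Radon–Nikodym theorem: functionals bounded with respect to `‖·‖₁` are of the form
`y ↦ τ (h * y)`. -/
theorem exists_eq_map_mul (φ : M.toStarSubalgebra →ₗ[ℂ] ℂ) {C : ℝ} (hC : 0 ≤ C)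
    (hφ : ∀ a b, ‖φ (a * b)‖ ≤ C * ‖τ.vec a‖ * ‖τ.vec b‖) :
    ∃ h : M.toStarSubalgebra, ‖h‖ ≤ C ∧ ∀ y, φ y = τ.toLinearMap (h * y) := by
  obtain ⟨ζ, hζ⟩ := τ.exists_vector_of_bounded φ (C := C) fun a => by
    simpa [norm_vec_one] using hφ 1 a
  suffices hmem : ζ ∈ closure (τ.vec '' Metric.closedBall 0 C) by
    obtain ⟨x, hx, rfl⟩ := τ.exists_vec_eq_of_mem_closure hmem
    refine ⟨star x, by rwa [norm_star], fun y => ?_⟩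
    rw [← hζ, inner_vec]
  -- Duality between `‖·‖₁` and the operator norm: a separating functional `η ≈ vec a` is tested on
  -- `C • u`, with `u` the approximate phase of `a`. Both sides are close to `C` times `T ≈ ‖a‖₁`,
  -- which contradicts the gap `g`.
  by_contra hmem
  obtain ⟨η, r, hr, hr'⟩ := exists_separating_vector τ.vecLin (convex_closedBall _ _)
    ⟨0, Metric.mem_closedBall_self hC⟩ hmem
  set g : ℝ := (⟪η, ζ⟫_ℂ).re - r with hg
  have hg0 : 0 < g := sub_pos.2 hr'
  -- `ε` bounds the error of replacing `η` by `vec a`, and `δ` that of the polar decomposition.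
  -- Together they cost at most `ε (‖ζ‖ + C) + C δ < g`.
  set ε : ℝ := g / (4 * (‖ζ‖ + C + 1)) with hε
  have hε0 : 0 < ε := by positivity
  set δ : ℝ := g / (4 * (C + 1)) with hδ
  have hδ0 : 0 < δ := by positivity
  obtain ⟨a, ha⟩ : ∃ a, ‖η - τ.vec a‖ < ε := by
    obtain ⟨a, ha⟩ := τ.denseRange_vec.exists_dist_lt η hε0
    exact ⟨a, by rwa [dist_eq_norm] at ha⟩
  obtain ⟨u, b, c, hu, rfl, hb, hc⟩ := exists_approx_polar a hδ0
  set a := b * c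
  set T : ℝ := (τ.toLinearMap (star a * u)).re with hT
  have hb' : ‖τ.vec b‖ ^ 2 ≤ T := by rw [norm_vec_sq]; exact τ.map_re_mono hb
  have hc' : ‖τ.vec c‖ ^ 2 ≤ T + 2 * δ := by
    rw [norm_vec_sq]
    refine (τ.map_re_mono hc).trans (le_of_eq ?_)
    rw [map_add, Complex.add_re, ← Complex.coe_smul, map_smul, τ.map_one]
    simp [hT]
  have hclose : ∀ v : τ.L2, |(⟪η, v⟫_ℂ).re - (⟪τ.vec a, v⟫_ℂ).re| ≤ ε * ‖v‖ := fun v => by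
    rw [← Complex.sub_re, ← inner_sub_left]
    refine (Complex.abs_re_le_norm _).trans ((norm_inner_le_norm _ _).trans ?_)
    gcongr
  have h1 : (⟪τ.vec a, ζ⟫_ℂ).re ≤ C * (T + δ) := by
    have h2 : ‖⟪τ.vec a, ζ⟫_ℂ‖ ≤ C * ‖τ.vec b‖ * ‖τ.vec c‖ := by
      rw [norm_inner_symm, hζ]; exact hφ b c
    refine (Complex.re_le_norm _).trans (h2.trans ?_)
    rw [mul_assoc]
    gcongr
    nlinarith [sq_nonneg (‖τ.vec b‖ - ‖τ.vec c‖)]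
  have h2 : (⟪η, τ.vec ((C : ℂ) • u)⟫_ℂ).re ≤ r := by
    refine hr _ (mem_closedBall_zero_iff.2 ?_)
    rw [norm_smul, Complex.norm_real, Real.norm_of_nonneg hC]
    exact mul_le_of_le_one_right hC hu
  have h3 : (⟪τ.vec a, τ.vec ((C : ℂ) • u)⟫_ℂ).re = C * T := by
    rw [inner_vec, mul_smul_comm, map_smul, smul_eq_mul, Complex.re_ofReal_mul]
  have h4 : ‖τ.vec ((C : ℂ) • u)‖ ≤ C := by
    refine (τ.norm_vec_le _).trans ?_
    rw [norm_smul, Complex.norm_real, Real.norm_of_nonneg hC]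
    exact mul_le_of_le_one_right hC hu
  have h5 := (abs_le.1 (hclose ζ)).2
  have h6 := (abs_le.1 (hclose (τ.vec ((C : ℂ) • u)))).1
  have h7 : ε * ‖τ.vec ((C : ℂ) • u)‖ ≤ ε * C := by gcongr
  have h8 : ε * (‖ζ‖ + C + 1) = g / 4 := by rw [hε]; field_simp
  have h9 : δ * (C + 1) = g / 4 := by rw [hδ]; field_simp
  nlinarith

end FaithfulNormalTrace

end VonNeumannAlgebra

/-! ### Subalgebras, expectations and Jones projections -/

namespace VonNeumannAlgebra

open Filter Topology

/-- Strong convergence of a bounded family of operators may be checked on a dense set. -/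
theorem tendsto_clm_apply_of_dense {E ι : Type*} [NormedAddCommGroup E] [NormedSpace ℂ E]
    {l : Filter ι} {T : ι → E →L[ℂ] E} {S : E →L[ℂ] E} {C : ℝ} (hT : ∀ i, ‖T i‖ ≤ C) {s : Set E}
    (hs : Dense s) (h : ∀ ξ ∈ s, Tendsto (fun i => T i ξ) l (𝓝 (S ξ))) (ξ : E) :
    Tendsto (fun i => T i ξ) l (𝓝 (S ξ)) := by
  rw [Metric.tendsto_nhds]
  intro ε hε
  set δ : ℝ := ε / (2 * (|C| + ‖S‖ + 1)) with hδ
  have hδ0 : 0 < δ := by positivity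
  obtain ⟨η, hη, hd⟩ := hs.exists_dist_lt ξ hδ0
  filter_upwards [Metric.tendsto_nhds.1 (h η hη) (ε / 2) (by positivity)] with i hi
  rw [dist_eq_norm] at *
  have h1 : ‖T i (ξ - η)‖ ≤ |C| * δ :=
    (T i).le_of_opNorm_le_of_le ((hT i).trans (le_abs_self C)) hd.le
  have h2 : ‖S (ξ - η)‖ ≤ ‖S‖ * δ := S.le_of_opNorm_le_of_le le_rfl hd.le
  have h3 : T i ξ - S ξ = T i (ξ - η) - S (ξ - η) + (T i η - S η) := by
    rw [map_sub, map_sub]; abel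
  have h4 : δ * (|C| + ‖S‖ + 1) = ε / 2 := by rw [hδ]; field_simp
  calc ‖T i ξ - S ξ‖ ≤ ‖T i (ξ - η)‖ + ‖S (ξ - η)‖ + ‖T i η - S η‖ := by
        rw [h3]; exact (norm_add_le _ _).trans (by gcongr; exact norm_sub_le _ _)
    _ < ε := by nlinarith

variable {H : Type*} [NormedAddCommGroup H] [InnerProductSpace ℂ H] [CompleteSpace H]

/-- The inclusion of a von Neumann subalgebra. -/
noncomputable def inclusion {M N : VonNeumannAlgebra H} (h : N ≤ M) :
    N.toStarSubalgebra →⋆ₐ[ℂ] M.toStarSubalgebra :=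
  StarSubalgebra.inclusion (S₁ := N.toStarSubalgebra) (S₂ := M.toStarSubalgebra)
    (fun _ hx => h hx)

theorem inclusion_mem {M N : VonNeumannAlgebra H} (h : N ≤ M) (x : N.toStarSubalgebra) :
    (inclusion h x : H →L[ℂ] H) ∈ N := x.2

theorem norm_inclusion {M N : VonNeumannAlgebra H} (h : N ≤ M) (x : N.toStarSubalgebra) :
    ‖inclusion h x‖ = ‖x‖ := rfl

theorem inclusion_mk {M N : VonNeumannAlgebra H} (h : N ≤ M) (x : M.toStarSubalgebra)
    (hx : (x : H →L[ℂ] H) ∈ N) : inclusion h ⟨x, hx⟩ = x := rfl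

namespace FaithfulNormalTrace

variable {M N : VonNeumannAlgebra H} (τ : M.FaithfulNormalTrace)

theorem restrict_apply (h : N ≤ M) (x : N.toStarSubalgebra) :
    (τ.restrict h).toLinearMap x = τ.toLinearMap (inclusion h x) := rfl

theorem norm_vec_restrict (h : N ≤ M) (x : N.toStarSubalgebra) :
    ‖(τ.restrict h).vec x‖ = ‖τ.vec (inclusion h x)‖ := by
  rw [← sq_eq_sq₀ (norm_nonneg _) (norm_nonneg _), norm_vec_sq, norm_vec_sq, restrict_apply,
    map_mul, StarHomClass.map_star]

/-! ### The commutant of `N` on `L²(M, τ)` -/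

theorem mem_commutantL2_of_commute {T : τ.L2 →L[ℂ] τ.L2}
    (h : ∀ x : M.toStarSubalgebra, (x : H →L[ℂ] H) ∈ N → τ.leftRep x * T = T * τ.leftRep x) :
    T ∈ (τ.commutantL2 N).toStarSubalgebra := by
  change _ ∈ StarSubalgebra.centralizer ℂ _
  rw [StarSubalgebra.mem_centralizer_iff]
  rintro _ ⟨x, hx, rfl⟩
  refine ⟨h x hx, ?_⟩
  rw [← StarHomClass.map_star]
  exact h (star x) (star_mem (s := N) hx)

theorem leftRep_mul_of_mem_commutantL2 (T : (τ.commutantL2 N).toStarSubalgebra)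
    {x : M.toStarSubalgebra} (hx : (x : H →L[ℂ] H) ∈ N) :
    τ.leftRep x * (T : τ.L2 →L[ℂ] τ.L2) = T * τ.leftRep x := by
  have h : (T : τ.L2 →L[ℂ] τ.L2) ∈ StarSubalgebra.centralizer ℂ _ := T.2
  rw [StarSubalgebra.mem_centralizer_iff] at h
  exact (h _ ⟨x, hx, rfl⟩).1

variable {E : M.toStarSubalgebra →ₗ[ℂ] M.toStarSubalgebra}

namespace IsCondExp

variable {τ}

theorem map_mul_left (hE : τ.IsCondExp N E) {a : M.toStarSubalgebra} (ha : (a : H →L[ℂ] H) ∈ N)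
    (x : M.toStarSubalgebra) : E (a * x) = a * E x := by
  have := hE.map_mul_mul a x 1 ha (one_mem N)
  rwa [mul_one, mul_one] at this

theorem map_mul_right (hE : τ.IsCondExp N E) {b : M.toStarSubalgebra} (hb : (b : H →L[ℂ] H) ∈ N)
    (x : M.toStarSubalgebra) : E (x * b) = E x * b := by
  have := hE.map_mul_mul 1 x b (one_mem N) hb
  rwa [one_mul, one_mul] at this

/-- Trace preservation and `N`-linearity make `x - E x` orthogonal to `L²(N)`. -/
theorem jonesProj_vec (hE : τ.IsCondExp N E) (x : M.toStarSubalgebra) :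
    τ.jonesProj N (τ.vec x) = τ.vec (E x) := by
  refine Submodule.eq_starProjection_of_mem_of_inner_eq_zero
    (Submodule.le_topologicalClosure _ (Submodule.subset_span ⟨E x, hE.mem x, rfl⟩)) ?_
  have hcl : IsClosed {w : τ.L2 | ⟪τ.vec x - τ.vec (E x), w⟫_ℂ = 0} :=
    isClosed_eq (by fun_prop) (by fun_prop)
  refine fun w hw => closure_minimal ?_ hcl hw
  intro w hw
  change ⟪_, _⟫_ℂ = 0
  induction hw using Submodule.span_induction with
  | mem w hw =>
    obtain ⟨n, hn, rfl⟩ := hw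
    rw [← vec_sub, inner_vec, ← hE.trace_map, hE.map_mul_right hn, hE.map_star, map_sub,
      hE.eq_self _ (hE.mem x), sub_self, star_zero, zero_mul, map_zero]
  | zero => simp
  | add v w _ _ hv hw => rw [inner_add_right, hv, hw, add_zero]
  | smul c w _ hw => rw [inner_smul_right, hw, mul_zero]

end IsCondExp

/-! ### Standard representations with a Jones projection -/

/-- A representation of `M` on a Hilbert space `𝓗` that is isomorphic to `L²(M, τ)`, together with
the Jones projection of `N`; the von Neumann algebra `P` is the commutant of `N`. -/
structure JonesData {𝓗 : Type*} [NormedAddCommGroup 𝓗] [InnerProductSpace ℂ 𝓗] [CompleteSpace 𝓗]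
    (τ : M.FaithfulNormalTrace) (N : VonNeumannAlgebra H)
    (E : M.toStarSubalgebra →ₗ[ℂ] M.toStarSubalgebra) (P : VonNeumannAlgebra 𝓗) where
  /-- The vector of an element of `M`. -/
  vec : M.toStarSubalgebra →ₗ[ℂ] 𝓗
  denseRange_vec : DenseRange vec
  inner_vec : ∀ x y, ⟪vec x, vec y⟫_ℂ = τ.toLinearMap (star x * y)
  /-- Left multiplication. -/
  left : M.toStarSubalgebra → 𝓗 →L[ℂ] 𝓗
  left_vec : ∀ x y, left x (vec y) = vec (x * y)
  /-- Right multiplication. -/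
  right : M.toStarSubalgebra → P.toStarSubalgebra
  right_vec : ∀ a x, (right a : 𝓗 →L[ℂ] 𝓗) (vec x) = vec (x * a)
  norm_right_le : ∀ a, ‖right a‖ ≤ ‖a‖
  /-- The Jones projection. -/
  jones : P.toStarSubalgebra
  jones_vec : ∀ x, (jones : 𝓗 →L[ℂ] 𝓗) (vec x) = vec (E x)
  norm_jones_le : ‖jones‖ ≤ 1
  apply_left : ∀ (T : P.toStarSubalgebra) (x : M.toStarSubalgebra), (x : H →L[ℂ] H) ∈ N →
    ∀ ξ, (T : 𝓗 →L[ℂ] 𝓗) (left x ξ) = left x ((T : 𝓗 →L[ℂ] 𝓗) ξ)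
  mem_of_commute : ∀ T : 𝓗 →L[ℂ] 𝓗,
    (∀ x : M.toStarSubalgebra, (x : H →L[ℂ] H) ∈ N → left x * T = T * left x) → T ∈ P

/-- The representation on `L²(M, τ)`. -/
noncomputable def jonesData (hE : τ.IsCondExp N E) : τ.JonesData N E (τ.commutantL2 N) where
  vec := τ.vecLin
  denseRange_vec := τ.denseRange_vec
  inner_vec := τ.inner_vec
  left := τ.leftRep
  left_vec := τ.leftRep_vec
  right a := ⟨τ.rightMul a, τ.mem_commutantL2_of_commute fun x _ => τ.leftRep_rightMul x a⟩
  right_vec := τ.rightMul_vec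
  norm_right_le := τ.norm_rightMul_le
  jones := ⟨τ.jonesProj N, τ.jonesProj_mem_commutantL2 N⟩
  jones_vec := hE.jonesProj_vec
  norm_jones_le := (τ.subspaceL2 N).starProjection_norm_le
  apply_left T _ hx ξ := (congrArg (fun S : τ.L2 →L[ℂ] τ.L2 => S ξ)
    (τ.leftRep_mul_of_mem_commutantL2 T hx)).symm
  mem_of_commute _ hT := τ.mem_commutantL2_of_commute hT

namespace JonesData

variable {𝓗 : Type*} [NormedAddCommGroup 𝓗] [InnerProductSpace ℂ 𝓗] [CompleteSpace 𝓗]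
  {P : VonNeumannAlgebra 𝓗} {τ} (D : τ.JonesData N E P)

theorem norm_vec (x : M.toStarSubalgebra) : ‖D.vec x‖ = ‖τ.vec x‖ := by
  rw [← sq_eq_sq₀ (norm_nonneg _) (norm_nonneg _), norm_vec_sq, ← D.inner_vec]
  exact (inner_self_eq_norm_sq (𝕜 := ℂ) _).symm

theorem ext_vec {ξ η : 𝓗} (h : ∀ x, ⟪D.vec x, ξ⟫_ℂ = ⟪D.vec x, η⟫_ℂ) : ξ = η := by
  refine D.denseRange_vec.eq_of_inner_left ℂ fun x => ?_
  rw [← inner_conj_symm, h, inner_conj_symm]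

theorem vec_injective : Function.Injective D.vec := fun x y h => by
  refine τ.vec_injective (sub_eq_zero.1 (norm_eq_zero.1 ?_))
  rw [← vec_sub, ← D.norm_vec, map_sub, h, sub_self, norm_zero]

theorem ext {S T : P.toStarSubalgebra}
    (h : ∀ x, (S : 𝓗 →L[ℂ] 𝓗) (D.vec x) = (T : 𝓗 →L[ℂ] 𝓗) (D.vec x)) : S = T :=
  Subtype.ext (ContinuousLinearMap.ext fun ξ => congrFun (D.denseRange_vec.equalizer
    (S : 𝓗 →L[ℂ] 𝓗).continuous (T : 𝓗 →L[ℂ] 𝓗).continuous (funext h)) ξ)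

theorem coe_mul_apply (S T : P.toStarSubalgebra) (ξ : 𝓗) :
    ((S * T : P.toStarSubalgebra) : 𝓗 →L[ℂ] 𝓗) ξ = (S : 𝓗 →L[ℂ] 𝓗) ((T : 𝓗 →L[ℂ] 𝓗) ξ) := rfl

theorem inner_star_apply (T : P.toStarSubalgebra) (ξ η : 𝓗) :
    ⟪ξ, ((star T : P.toStarSubalgebra) : 𝓗 →L[ℂ] 𝓗) η⟫_ℂ = ⟪(T : 𝓗 →L[ℂ] 𝓗) ξ, η⟫_ℂ :=
  ContinuousLinearMap.adjoint_inner_right (T : 𝓗 →L[ℂ] 𝓗) ξ η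

theorem right_mul (a b : M.toStarSubalgebra) : D.right (a * b) = D.right b * D.right a :=
  D.ext fun x => by rw [coe_mul_apply, right_vec, right_vec, right_vec, mul_assoc]

theorem right_one : D.right 1 = 1 :=
  D.ext fun x => by rw [right_vec, mul_one]; rfl

theorem right_add (a b : M.toStarSubalgebra) : D.right (a + b) = D.right a + D.right b :=
  D.ext fun x => by
    change _ = (D.right a : 𝓗 →L[ℂ] 𝓗) (D.vec x) + (D.right b : 𝓗 →L[ℂ] 𝓗) (D.vec x)
    rw [right_vec, right_vec, right_vec, mul_add, map_add]

theorem right_smul (c : ℂ) (a : M.toStarSubalgebra) : D.right (c • a) = c • D.right a :=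
  D.ext fun x => by
    change _ = c • (D.right a : 𝓗 →L[ℂ] 𝓗) (D.vec x)
    rw [right_vec, right_vec, mul_smul_comm, map_smul]

theorem right_zero : D.right 0 = 0 :=
  D.ext fun x => by
    rw [right_vec, mul_zero, map_zero]; rfl

theorem star_right (a : M.toStarSubalgebra) : star (D.right a) = D.right (star a) :=
  D.ext fun x => D.ext_vec fun y => by
    rw [inner_star_apply, right_vec, right_vec, inner_vec, inner_vec, star_mul, mul_assoc,
      τ.map_mul_comm, mul_assoc]

theorem inner_left (x : M.toStarSubalgebra) (ξ η : 𝓗) :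
    ⟪D.left x ξ, η⟫_ℂ = ⟪ξ, D.left (star x) η⟫_ℂ := by
  refine D.denseRange_vec.induction_on
    (p := fun ξ => ⟪D.left x ξ, η⟫_ℂ = ⟪ξ, D.left (star x) η⟫_ℂ) ξ
    (isClosed_eq (by fun_prop) (by fun_prop)) fun y => ?_
  refine D.denseRange_vec.induction_on
    (p := fun η => ⟪D.left x (D.vec y), η⟫_ℂ = ⟪D.vec y, D.left (star x) η⟫_ℂ) η
    (isClosed_eq (by fun_prop) (by fun_prop)) fun z => ?_
  rw [left_vec, left_vec, inner_vec, inner_vec, star_mul, mul_assoc]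

theorem star_jones (hE : τ.IsCondExp N E) : star D.jones = D.jones :=
  D.ext fun x => D.ext_vec fun y => by
    rw [inner_star_apply, jones_vec, jones_vec, inner_vec, inner_vec, ← hE.trace_map,
      ← hE.trace_map (star y * E x), ← hE.map_star, hE.map_mul_left (hE.mem _),
      hE.map_mul_right (hE.mem _)]

theorem jones_mul_self (hE : τ.IsCondExp N E) : D.jones * D.jones = D.jones :=
  D.ext fun x => by rw [coe_mul_apply, jones_vec, jones_vec, hE.eq_self _ (hE.mem x)]

/-- `e x e = E(x) e` for right multiplications. -/
theorem jones_mul_right_mul_jones (hE : τ.IsCondExp N E) (a : M.toStarSubalgebra) :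
    D.jones * D.right a * D.jones = D.right (E a) * D.jones :=
  D.ext fun x => by
    simp only [coe_mul_apply, jones_vec, right_vec, hE.map_mul_left (hE.mem x)]

theorem jones_mul_right (hE : τ.IsCondExp N E) {a : M.toStarSubalgebra} (ha : (a : H →L[ℂ] H) ∈ N) :
    D.jones * D.right a = D.right a * D.jones :=
  D.ext fun x => by
    simp only [coe_mul_apply, jones_vec, right_vec, hE.map_mul_right ha]

end JonesData

end FaithfulNormalTrace

end VonNeumannAlgebra

namespace VonNeumannAlgebra

open Filter Topology

variable {H : Type*} [NormedAddCommGroup H] [InnerProductSpace ℂ H] [CompleteSpace H]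

namespace FaithfulNormalTrace

variable {M N : VonNeumannAlgebra H} {τ : M.FaithfulNormalTrace}
  {E : M.toStarSubalgebra →ₗ[ℂ] M.toStarSubalgebra}

namespace JonesData

variable {𝓗 : Type*} [NormedAddCommGroup 𝓗] [InnerProductSpace ℂ 𝓗] [CompleteSpace 𝓗]
  {P : VonNeumannAlgebra 𝓗} (D : τ.JonesData N E P)

/-! ### Traces on the commutant -/

theorem tendsto_right_apply {c : ℕ → M.toStarSubalgebra} {y : M.toStarSubalgebra} {C : ℝ}
    (hc : ∀ n, ‖c n‖ ≤ C) (h : Tendsto (fun n => D.vec (c n)) atTop (𝓝 (D.vec y))) (ξ : 𝓗) :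
    Tendsto (fun n => (D.right (c n) : 𝓗 →L[ℂ] 𝓗) ξ) atTop
      (𝓝 ((D.right y : 𝓗 →L[ℂ] 𝓗) ξ)) := by
  refine tendsto_clm_apply_of_dense (T := fun n => (D.right (c n) : 𝓗 →L[ℂ] 𝓗))
    (fun n => (D.norm_right_le _).trans (hc n)) D.denseRange_vec ?_ ξ
  rintro _ ⟨b, rfl⟩
  simp only [right_vec, ← left_vec]
  exact ((D.left b).continuous.tendsto _).comp h

/-- Traces of right multiplications by a subfactor, cut down by a commuting element. -/
theorem map_right_mul (τ' : P.FaithfulNormalTrace) {Q : VonNeumannAlgebra H}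
    (hQM : Q ≤ M) (hQ : ∀ x ∈ Q, x ∈ Q.commutant → ∃ c : ℂ, x = c • (1 : H →L[ℂ] H))
    (S : P.toStarSubalgebra)
    (hS : ∀ y : M.toStarSubalgebra, (y : H →L[ℂ] H) ∈ Q → S * D.right y = D.right y * S)
    {y : M.toStarSubalgebra} (hy : (y : H →L[ℂ] H) ∈ Q) :
    τ'.toLinearMap (D.right y * S) = τ.toLinearMap y * τ'.toLinearMap S := by
  let φ : Q.toStarSubalgebra →ₗ[ℂ] ℂ :=
    { toFun := fun y => τ'.toLinearMap (D.right (inclusion hQM y) * S)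
      map_add' := fun a b => by rw [map_add, right_add, add_mul, map_add]
      map_smul' := fun c a => by
        rw [map_smul, right_smul, smul_mul_assoc, map_smul, RingHom.id_apply] }
  have key := (τ.restrict hQM).eq_mul_of_conj_invariant hQ φ ?_ ?_ ⟨y, hy⟩
  · change τ'.toLinearMap (D.right (inclusion hQM ⟨y, hy⟩) * S) =
      τ.toLinearMap (inclusion hQM ⟨y, hy⟩) *
        τ'.toLinearMap (D.right (inclusion hQM 1) * S) at key
    rwa [_root_.map_one, right_one, one_mul] at key
  -- Right multiplication reverses products and `S` commutes with those from `Q`, so traciality of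
  -- `τ'` cancels `u` against `star u`.
  · intro u hu x
    change τ'.toLinearMap (D.right (inclusion hQM (u * x * star u)) * S) =
      τ'.toLinearMap (D.right (inclusion hQM x) * S)
    rw [map_mul (inclusion hQM), map_mul (inclusion hQM), right_mul, right_mul,
      mul_assoc, τ'.map_mul_comm, mul_assoc,
      mul_assoc, hS _ (inclusion_mem hQM _), ← mul_assoc (D.right (inclusion hQM u)),
      ← right_mul, ← map_mul, Unitary.star_mul_self_of_mem hu, _root_.map_one, right_one, one_mul]
  · intro c y C hc h
    have h' : Tendsto (fun n => D.vec (inclusion hQM (c n))) atTop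
        (𝓝 (D.vec (inclusion hQM y))) := by
      rw [tendsto_iff_norm_sub_tendsto_zero] at h ⊢
      refine h.congr fun n => ?_
      rw [← vec_sub, ← map_sub, D.norm_vec, norm_vec_restrict, map_sub]
    have h0 : 0 ≤ C := (norm_nonneg _).trans (hc 0)
    refine τ'.tendsto_of_weak (C := C * ‖S‖) (fun n => ?_) fun ξ η => ?_
    · exact (norm_mul_le _ _).trans (by gcongr; exact (D.norm_right_le _).trans (hc n))
    · exact tendsto_const_nhds.inner (D.tendsto_right_apply
        (c := fun n => inclusion hQM (c n)) hc h' ((S : 𝓗 →L[ℂ] 𝓗) ξ))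

theorem map_right (τ' : P.FaithfulNormalTrace)
    (hM : ∀ x ∈ M, x ∈ M.commutant → ∃ c : ℂ, x = c • (1 : H →L[ℂ] H)) (y : M.toStarSubalgebra) :
    τ'.toLinearMap (D.right y) = τ.toLinearMap y := by
  have := D.map_right_mul τ' le_rfl hM 1 (fun y _ => by rw [one_mul, mul_one]) y.2
  rwa [mul_one, τ'.map_one, mul_one] at this

theorem map_right_mul_jones (τ' : P.FaithfulNormalTrace) (hNM : N ≤ M)
    (hN : ∀ x ∈ N, x ∈ N.commutant → ∃ c : ℂ, x = c • (1 : H →L[ℂ] H)) (hE : τ.IsCondExp N E)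
    {y : M.toStarSubalgebra} (hy : (y : H →L[ℂ] H) ∈ N) :
    τ'.toLinearMap (D.right y * D.jones) = τ.toLinearMap y * τ'.toLinearMap D.jones :=
  D.map_right_mul τ' hNM hN _ (fun _ h => D.jones_mul_right hE h) hy

/-- The trace of the projection is its squared `‖·‖₂`-norm, and the projection fixes the unit vector
`vec 1`. -/
theorem map_jones_pos (τ' : P.FaithfulNormalTrace) (hE : τ.IsCondExp N E) :
    0 < (τ'.toLinearMap D.jones).re := by
  have h1 := τ'.norm_vec_sq D.jones
  rw [D.star_jones hE, D.jones_mul_self hE] at h1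
  rw [← h1]
  refine pow_pos (norm_pos_iff.2 fun h => ?_) 2
  have h2 := D.jones_vec 1
  rw [τ'.vec_eq_zero.1 h, hE.eq_self 1 (one_mem N)] at h2
  have := τ.norm_vec_one
  rw [← D.norm_vec, ← h2] at this
  exact zero_ne_one (norm_zero.symm.trans this)

theorem map_jones_eq_re (τ' : P.FaithfulNormalTrace) (hE : τ.IsCondExp N E) :
    τ'.toLinearMap D.jones = ((τ'.toLinearMap D.jones).re : ℂ) := by
  refine τ'.map_eq_re_of_nonneg ?_
  have := star_mul_self_nonneg D.jones
  rwa [D.star_jones hE, D.jones_mul_self hE] at this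

/-- The trace of a corner of the commutant. -/
theorem map_jones_mul_mul_jones (τ' : P.FaithfulNormalTrace) (hNM : N ≤ M)
    (hN : ∀ x ∈ N, x ∈ N.commutant → ∃ c : ℂ, x = c • (1 : H →L[ℂ] H)) (hE : τ.IsCondExp N E)
    (A : P.toStarSubalgebra) :
    τ'.toLinearMap (D.jones * A * D.jones) =
      ⟪D.vec 1, (A : 𝓗 →L[ℂ] 𝓗) (D.vec 1)⟫_ℂ * τ'.toLinearMap D.jones := by
  let φ : N.toStarSubalgebra →ₗ[ℂ] ℂ :=
    { toFun := fun n => ⟪D.vec 1, (A : 𝓗 →L[ℂ] 𝓗) (D.vec (inclusion hNM n))⟫_ℂ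
      map_add' := fun a b => by rw [map_add, map_add, map_add, inner_add_right]
      map_smul' := fun c a => by
        rw [map_smul, map_smul, map_smul, inner_smul_right, RingHom.id_apply, smul_eq_mul] }
  have hφ : ∀ a b : N.toStarSubalgebra, φ (a * b) = ⟪D.vec (inclusion hNM (star a)),
      (A : 𝓗 →L[ℂ] 𝓗) (D.vec (inclusion hNM b))⟫_ℂ := fun a b => by
    change ⟪D.vec 1, (A : 𝓗 →L[ℂ] 𝓗) (D.vec (inclusion hNM (a * b)))⟫_ℂ = _
    rw [map_mul, ← left_vec, D.apply_left A _ (inclusion_mem hNM a), StarHomClass.map_star]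
    nth_rewrite 1 [← star_star (inclusion hNM a)]
    rw [← inner_left, left_vec, mul_one]
  -- `A` commutes with left multiplication by `N`, so `φ (a * b)` is a matrix coefficient of `A`
  -- between the vectors of `star a` and `b`; this gives the `‖·‖₁`-type bound.
  obtain ⟨h, -, hh⟩ := (τ.restrict hNM).exists_eq_map_mul φ (norm_nonneg A) fun a b => by
    rw [hφ, ← norm_vec_star, norm_vec_restrict, norm_vec_restrict, mul_comm ‖A‖, mul_assoc,
      ← D.norm_vec, ← D.norm_vec]
    refine (norm_inner_le_norm _ _).trans ?_
    gcongr
    exact (A : 𝓗 →L[ℂ] 𝓗).le_opNorm _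
  -- The coefficients of the corner on `L²(N)` are values of `φ`, hence those of right
  -- multiplication by `h`.
  have hcorner : D.jones * A * D.jones = D.right (inclusion hNM h) * D.jones := by
    rw [← D.jones_mul_right hE (inclusion_mem hNM h)]
    refine D.ext fun x => D.ext_vec fun y => ?_
    have h1 := hh (star (⟨E y, hE.mem y⟩ : N.toStarSubalgebra) * ⟨E x, hE.mem x⟩)
    rw [hφ, star_star, inclusion_mk hNM _ (hE.mem y), inclusion_mk hNM _ (hE.mem x)] at h1
    rw [coe_mul_apply, coe_mul_apply, coe_mul_apply, ← D.star_jones hE, inner_star_apply,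
      D.star_jones hE, jones_vec, jones_vec, h1, right_vec, jones_vec, restrict_apply,
      map_mul (inclusion hNM), map_mul (inclusion hNM), StarHomClass.map_star,
      inclusion_mk hNM _ (hE.mem y),
      inclusion_mk hNM _ (hE.mem x), τ.map_mul_comm, mul_assoc, inner_vec,
      hE.map_mul_right (inclusion_mem hNM h), ← hE.trace_map (star y * _),
      hE.map_mul_right (mul_mem (s := N) (hE.mem x) (inclusion_mem hNM h)), hE.map_star]
  rw [hcorner, D.map_right_mul_jones τ' hNM hN hE (inclusion_mem hNM h)]
  have h1 := hh 1
  rw [mul_one, restrict_apply] at h1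
  rw [← h1]
  change ⟪D.vec 1, (A : 𝓗 →L[ℂ] 𝓗) (D.vec (inclusion hNM 1))⟫_ℂ * _ = _
  rw [_root_.map_one (inclusion hNM)]

/-- Right multiplication is a `⋆`-anti-homomorphism that preserves the traces. -/
theorem norm_vec_right (τ' : P.FaithfulNormalTrace)
    (hM : ∀ x ∈ M, x ∈ M.commutant → ∃ c : ℂ, x = c • (1 : H →L[ℂ] H)) (a : M.toStarSubalgebra) :
    ‖τ'.vec (D.right a)‖ = ‖τ.vec a‖ := by
  rw [← sq_eq_sq₀ (norm_nonneg _) (norm_nonneg _), norm_vec_sq, norm_vec_sq, star_right,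
    ← right_mul, D.map_right τ' hM, τ.map_mul_comm]

/-- The push-down lemma: when the commutant of `N` is finite, its elements map the trace vector
to vectors coming from `M`. -/
theorem exists_vec_eq_apply (τ' : P.FaithfulNormalTrace) (hNM : N ≤ M)
    (hM : ∀ x ∈ M, x ∈ M.commutant → ∃ c : ℂ, x = c • (1 : H →L[ℂ] H))
    (hN : ∀ x ∈ N, x ∈ N.commutant → ∃ c : ℂ, x = c • (1 : H →L[ℂ] H)) (hE : τ.IsCondExp N E)
    (T : P.toStarSubalgebra) :
    ∃ z : M.toStarSubalgebra, D.vec z = (T : 𝓗 →L[ℂ] 𝓗) (D.vec 1) ∧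
      ‖z‖ ≤ (τ'.toLinearMap D.jones).re⁻¹ * ‖T‖ := by
  set t : ℝ := (τ'.toLinearMap D.jones).re with ht
  have ht0 : 0 < t := D.map_jones_pos τ' hE
  have htC : τ'.toLinearMap D.jones = (t : ℂ) := D.map_jones_eq_re τ' hE
  let φ : M.toStarSubalgebra →ₗ[ℂ] ℂ :=
    { toFun := fun y => ⟪D.vec 1, ((D.right y * T : P.toStarSubalgebra) : 𝓗 →L[ℂ] 𝓗) (D.vec 1)⟫_ℂ
      map_add' := fun a b => by
        rw [right_add, add_mul, ← inner_add_right]; rfl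
      map_smul' := fun c a => by
        rw [right_smul, smul_mul_assoc, RingHom.id_apply, smul_eq_mul, ← inner_smul_right]; rfl }
  have hφ : ∀ y, φ y * t = τ'.toLinearMap (D.right y * T * D.jones) := fun y => by
    have h1 := D.map_jones_mul_mul_jones τ' hNM hN hE (D.right y * T)
    rw [mul_assoc, τ'.map_mul_comm, mul_assoc, D.jones_mul_self hE, htC] at h1
    exact h1.symm
  -- Multiplied by `t`, this is an inner product in `L²(P, τ')` of `R(star a)` with `T e R(b)`.
  -- Cauchy–Schwarz applies, since `R` preserves `‖·‖₂`.
  have hbd : ∀ a b, ‖φ (a * b)‖ ≤ (t⁻¹ * ‖T‖) * ‖τ.vec a‖ * ‖τ.vec b‖ := fun a b => by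
    have h1 : φ (a * b) * t = ⟪τ'.vec (D.right (star a)),
        τ'.vec (T * D.jones * D.right b)⟫_ℂ := by
      rw [hφ, FaithfulNormalTrace.inner_vec, star_right, star_star, right_mul, mul_assoc,
        mul_assoc, τ'.map_mul_comm]
      simp only [mul_assoc]
    have h2 : ‖φ (a * b)‖ * t ≤ ‖τ.vec a‖ * (‖T‖ * ‖τ.vec b‖) := by
      rw [← Real.norm_of_nonneg ht0.le, ← Complex.norm_real t, ← norm_mul, h1]
      refine (norm_inner_le_norm _ _).trans ?_
      rw [D.norm_vec_right τ' hM, norm_vec_star]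
      gcongr
      refine (τ'.norm_vec_mul_le _ _).trans ?_
      rw [D.norm_vec_right τ' hM]
      gcongr
      exact (norm_mul_le _ _).trans (mul_le_of_le_one_right (norm_nonneg _) D.norm_jones_le)
    rw [← le_div_iff₀ ht0] at h2
    refine h2.trans (le_of_eq ?_)
    rw [div_eq_inv_mul]; ring
  obtain ⟨z, hz, hzφ⟩ := τ.exists_eq_map_mul φ (by positivity) hbd
  refine ⟨z, D.ext_vec fun x => ?_, hz⟩
  rw [inner_vec, τ.map_mul_comm, ← hzφ]
  change ⟪D.vec 1, ((D.right (star x) * T : P.toStarSubalgebra) : 𝓗 →L[ℂ] 𝓗) (D.vec 1)⟫_ℂ = _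
  rw [coe_mul_apply, ← star_right, inner_star_apply, right_vec, one_mul]

end JonesData

end FaithfulNormalTrace

end VonNeumannAlgebra

/-! ### Positivity, frame operators and maximal orthogonal families -/

namespace VonNeumannAlgebra

open Filter Topology

/-- A sum of mutually orthogonal positive contractions `v i * star (v i)`. -/
theorem sum_mul_star_mul_self_le {B ι : Type*} [CStarAlgebra B] [PartialOrder B]
    [StarOrderedRing B] (s : Finset ι) (v : ι → B)
    (horth : ∀ i ∈ s, ∀ j ∈ s, i ≠ j → star (v i) * v j = 0) (hv : ∀ i ∈ s, ‖v i‖ ≤ 1) :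
    (∑ i ∈ s, v i * star (v i)) * (∑ i ∈ s, v i * star (v i)) ≤ ∑ i ∈ s, v i * star (v i) := by
  rw [Finset.sum_mul_sum]
  refine Finset.sum_le_sum fun i hi => ?_
  rw [Finset.sum_eq_single_of_mem i hi fun j hj hij => by
    rw [mul_assoc, ← mul_assoc (star _), horth i hi j hj hij.symm, zero_mul, mul_zero]]
  have h1 : star (v i) * v i ≤ 1 := by
    rw [← CStarAlgebra.norm_le_one_iff_of_nonneg _ (star_mul_self_nonneg _),
      CStarRing.norm_star_mul_self]
    exact mul_le_one₀ (hv i hi) (norm_nonneg _) (hv i hi)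
  have h2 := star_right_conjugate_le_conjugate h1 (v i)
  rw [mul_one] at h2
  simpa only [mul_assoc] using h2

variable {H : Type*} [NormedAddCommGroup H] [InnerProductSpace ℂ H] [CompleteSpace H]

namespace FaithfulNormalTrace

variable {M N : VonNeumannAlgebra H} {τ : M.FaithfulNormalTrace}
  {E : M.toStarSubalgebra →ₗ[ℂ] M.toStarSubalgebra}

theorem norm_map_le (τ : M.FaithfulNormalTrace) (x : M.toStarSubalgebra) :
    ‖τ.toLinearMap x‖ ≤ ‖x‖ := by
  have h := norm_inner_le_norm (𝕜 := ℂ) (τ.vec 1) (τ.vec x)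
  rw [inner_vec, star_one, one_mul, norm_vec_one, one_mul] at h
  exact h.trans (τ.norm_vec_le x)

namespace IsCondExp

/-- Let `h = E (y * star y)` and `h⁻ = star s * s` with `s` in `N`. Then `τ (h * h⁻) = τ (s y (s
y)*) ≥ 0`, but `h * h⁻ = -(h⁻)²`, so faithfulness kills `h⁻`. -/
theorem nonneg (hNM : N ≤ M) (hE : τ.IsCondExp N E) (y : M.toStarSubalgebra) :
    0 ≤ (⟨E (y * star y), hE.mem _⟩ : N.toStarSubalgebra) := by
  set h : N.toStarSubalgebra := ⟨E (y * star y), hE.mem _⟩ with hh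
  have hincl : inclusion hNM h = E (y * star y) := rfl
  have hsa : IsSelfAdjoint h := by
    have h0 : star (E (y * star y)) = E (y * star y) := by rw [← hE.map_star, star_mul, star_star]
    exact Subtype.ext (congrArg (fun z : M.toStarSubalgebra => (z : H →L[ℂ] H)) h0)
  obtain ⟨s, hs⟩ := N.exists_eq_star_mul_self (CFC.negPart_nonneg h)
  have h1 : 0 ≤ ((τ.restrict hNM).toLinearMap (h * h⁻)).re := by
    rw [hs, ← mul_assoc, (τ.restrict hNM).map_mul_comm, ← mul_assoc, restrict_apply,
      map_mul (inclusion hNM), map_mul (inclusion hNM), hincl,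
      ← hE.map_mul_mul _ _ _ (inclusion_mem hNM _) (inclusion_mem hNM _), hE.trace_map,
      StarHomClass.map_star, ← mul_assoc, mul_assoc, ← star_mul]
    exact (Complex.nonneg_iff.1 (τ.map_nonneg (mul_star_self_nonneg _))).1
  have h2 : h * h⁻ = -(star h⁻ * h⁻) := by
    have h3 : star h⁻ = h⁻ := (IsSelfAdjoint.of_nonneg (CFC.negPart_nonneg h)).star_eq
    conv_lhs => rw [← CFC.posPart_sub_negPart h hsa]
    rw [h3, CFC.posPart_sub_negPart h hsa]
    nth_rewrite 1 [← CFC.posPart_sub_negPart h hsa]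
    rw [sub_mul, CFC.posPart_mul_negPart, zero_sub]
  rw [h2, map_neg, Complex.neg_re, ← norm_vec_sq] at h1
  have h4 : (τ.restrict hNM).vec h⁻ = 0 := by
    rw [← norm_eq_zero]
    nlinarith [norm_nonneg ((τ.restrict hNM).vec h⁻)]
  rw [vec_eq_zero] at h4
  rw [← CFC.posPart_sub_negPart h hsa, h4, sub_zero]
  exact CFC.posPart_nonneg h

end IsCondExp

/-- The elements `b i`, `i ∈ s`, are orthogonal for the `N`-valued inner product `E (x * star y)`,
and their `N`-valued norms are at most one. -/
structure IsSubOrthonormal {ι : Type*} (E : M.toStarSubalgebra →ₗ[ℂ] M.toStarSubalgebra)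
    (s : Finset ι) (b : ι → M.toStarSubalgebra) : Prop where
  orthogonal : ∀ i ∈ s, ∀ j ∈ s, i ≠ j → E (b i * star (b j)) = 0
  norm_le_one : ∀ i ∈ s, ‖E (b i * star (b i))‖ ≤ 1

namespace JonesData

variable {𝓗 : Type*} [NormedAddCommGroup 𝓗] [InnerProductSpace ℂ 𝓗] [CompleteSpace 𝓗]
  {P : VonNeumannAlgebra 𝓗} (D : τ.JonesData N E P)

/-! ### Orthogonal families and their frame operators -/

/-- The frame operator `x ↦ ∑ i, E (x * star (b i)) * b i` of a finite family. -/
noncomputable def frame {ι : Type*} (s : Finset ι) (b : ι → M.toStarSubalgebra) :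
    P.toStarSubalgebra :=
  ∑ i ∈ s, D.right (b i) * D.jones * D.right (star (b i))

theorem coe_sum_apply {ι : Type*} (s : Finset ι) (T : ι → P.toStarSubalgebra) (ξ : 𝓗) :
    ((∑ i ∈ s, T i : P.toStarSubalgebra) : 𝓗 →L[ℂ] 𝓗) ξ = ∑ i ∈ s, (T i : 𝓗 →L[ℂ] 𝓗) ξ := by
  rw [AddSubmonoidClass.coe_finsetSum, _root_.sum_apply]

theorem frame_vec {ι : Type*} (s : Finset ι) (b : ι → M.toStarSubalgebra)
    (x : M.toStarSubalgebra) :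
    (D.frame s b : 𝓗 →L[ℂ] 𝓗) (D.vec x) = D.vec (∑ i ∈ s, E (x * star (b i)) * b i) := by
  rw [frame, coe_sum_apply, map_sum]
  refine Finset.sum_congr rfl fun i _ => ?_
  rw [coe_mul_apply, coe_mul_apply, right_vec, jones_vec, right_vec]

theorem frame_eq (hE : τ.IsCondExp N E) {ι : Type*} (s : Finset ι) (b : ι → M.toStarSubalgebra) :
    D.frame s b = ∑ i ∈ s, D.right (b i) * D.jones * star (D.right (b i) * D.jones) := by
  refine Finset.sum_congr rfl fun i _ => ?_
  rw [star_mul, D.star_jones hE, star_right, mul_assoc, mul_assoc, ← mul_assoc D.jones D.jones,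
    D.jones_mul_self hE]

/-- With `v = R(b) e`, traciality exchanges `v v*` for `v* v = e R(b b*) e = R(E(b b*)) e`. The
subalgebra `N` influences the result only through the trace of its Jones projection. -/
theorem map_frame (τ' : P.FaithfulNormalTrace) (hNM : N ≤ M)
    (hN : ∀ x ∈ N, x ∈ N.commutant → ∃ c : ℂ, x = c • (1 : H →L[ℂ] H)) (hE : τ.IsCondExp N E)
    {ι : Type*} (s : Finset ι) (b : ι → M.toStarSubalgebra) :
    τ'.toLinearMap (D.frame s b) =
      (∑ i ∈ s, τ.toLinearMap (b i * star (b i))) * τ'.toLinearMap D.jones := by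
  rw [D.frame_eq hE, map_sum, Finset.sum_mul]
  refine Finset.sum_congr rfl fun i _ => ?_
  rw [τ'.map_mul_comm, star_mul, D.star_jones hE, star_right, ← mul_assoc,
    mul_assoc D.jones, ← right_mul, D.jones_mul_right_mul_jones hE,
    D.map_right_mul_jones τ' hNM hN hE (hE.mem _), hE.trace_map]

/-- The products `v i* v j = R(E(b j (b i)*)) e` vanish off the diagonal and have norm at most one
on it. -/
theorem frame_mul_self_le (hE : τ.IsCondExp N E) {ι : Type*} {s : Finset ι}
    {b : ι → M.toStarSubalgebra} (hb : IsSubOrthonormal E s b) :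
    D.frame s b * D.frame s b ≤ D.frame s b := by
  have key : ∀ i j, star (D.right (b i) * D.jones) * (D.right (b j) * D.jones) =
      D.right (E (b j * star (b i))) * D.jones := fun i j => by
    rw [star_mul, D.star_jones hE, star_right, ← mul_assoc, mul_assoc D.jones, ← right_mul,
      D.jones_mul_right_mul_jones hE]
  rw [D.frame_eq hE]
  refine sum_mul_star_mul_self_le s (fun i => D.right (b i) * D.jones)
    (fun i hi j hj hij => ?_) fun i hi => ?_
  · rw [key, hb.orthogonal j hj i hi hij.symm, right_zero, zero_mul]
  · have h1 : ‖D.right (b i) * D.jones‖ * ‖D.right (b i) * D.jones‖ ≤ 1 := by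
      rw [← CStarRing.norm_star_mul_self, key]
      refine (norm_mul_le _ _).trans (mul_le_one₀ ?_ (norm_nonneg _) D.norm_jones_le)
      exact (D.norm_right_le _).trans (hb.norm_le_one i hi)
    nlinarith [norm_nonneg (D.right (b i) * D.jones)]

theorem star_frame (hE : τ.IsCondExp N E) {ι : Type*} (s : Finset ι)
    (b : ι → M.toStarSubalgebra) : star (D.frame s b) = D.frame s b := by
  rw [D.frame_eq hE, star_sum]
  refine Finset.sum_congr rfl fun i _ => ?_
  rw [star_mul, star_star]

theorem frame_nonneg (hE : τ.IsCondExp N E) {ι : Type*} (s : Finset ι)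
    (b : ι → M.toStarSubalgebra) : 0 ≤ D.frame s b := by
  rw [D.frame_eq hE]
  exact Finset.sum_nonneg fun i _ => mul_star_self_nonneg _

/-- Under the trace this bounds `‖1 - F‖₂²` by `1 - tr F`. -/
theorem star_one_sub_frame_mul_self_le (hE : τ.IsCondExp N E) {ι : Type*} {s : Finset ι}
    {b : ι → M.toStarSubalgebra} (hb : IsSubOrthonormal E s b) :
    star (1 - D.frame s b) * (1 - D.frame s b) ≤ 1 - D.frame s b := by
  have h : star (1 - D.frame s b) * (1 - D.frame s b) =
      1 - D.frame s b - (D.frame s b - D.frame s b * D.frame s b) := by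
    rw [star_sub, star_one, D.star_frame hE]; noncomm_ring
  rw [h]
  exact sub_le_self _ (sub_nonneg.2 (D.frame_mul_self_le hE hb))

theorem frame_le_one (hE : τ.IsCondExp N E) {ι : Type*} {s : Finset ι}
    {b : ι → M.toStarSubalgebra} (hb : IsSubOrthonormal E s b) : D.frame s b ≤ 1 :=
  sub_nonneg.1 ((star_mul_self_nonneg _).trans (D.star_one_sub_frame_mul_self_le hE hb))

theorem norm_frame_le_one (hE : τ.IsCondExp N E) {ι : Type*} {s : Finset ι}
    {b : ι → M.toStarSubalgebra} (hb : IsSubOrthonormal E s b) : ‖D.frame s b‖ ≤ 1 :=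
  (CStarAlgebra.norm_le_one_iff_of_nonneg _ (D.frame_nonneg hE s b)).2 (D.frame_le_one hE hb)

/-- If the traces of the frame operators of orthogonal families tend to one, then their frame
expansions converge in `L²` and stay bounded in norm. -/
theorem frame_expansion_tendsto (τ' : P.FaithfulNormalTrace) (hNM : N ≤ M)
    (hM : ∀ x ∈ M, x ∈ M.commutant → ∃ c : ℂ, x = c • (1 : H →L[ℂ] H))
    (hN : ∀ x ∈ N, x ∈ N.commutant → ∃ c : ℂ, x = c • (1 : H →L[ℂ] H)) (hE : τ.IsCondExp N E)
    {ι : Type*} (s : ℕ → Finset ι) (b : ℕ → ι → M.toStarSubalgebra)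
    (hb : ∀ n, IsSubOrthonormal E (s n) (b n))
    (hlim : Tendsto (fun n => (τ'.toLinearMap (D.frame (s n) (b n))).re) atTop (𝓝 1))
    (x : M.toStarSubalgebra) :
    (∃ C, ∀ n, ‖∑ i ∈ s n, E (x * star (b n i)) * b n i‖ ≤ C) ∧
      Tendsto (fun n => τ.vec (∑ i ∈ s n, E (x * star (b n i)) * b n i - x)) atTop (𝓝 0) := by
  constructor
  · refine ⟨(τ'.toLinearMap D.jones).re⁻¹ * ‖x‖, fun n => ?_⟩
    -- `F R(x)` sends `vec 1` to the vector of the expansion of `x` and has norm at most `‖x‖`;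
    -- push-down then bounds the expansion uniformly in `n`.
    obtain ⟨z, hz, hzn⟩ := D.exists_vec_eq_apply τ' hNM hM hN hE (D.frame (s n) (b n) * D.right x)
    rw [coe_mul_apply, right_vec, one_mul, frame_vec] at hz
    rw [← D.vec_injective hz]
    refine hzn.trans ?_
    have := (D.map_jones_pos τ' hE).le
    gcongr
    refine (norm_mul_le _ _).trans ?_
    exact (mul_le_of_le_one_left (norm_nonneg _) (D.norm_frame_le_one hE (hb n))).trans
      (D.norm_right_le x)
  · have hb2 : ∀ n, ‖1 - D.frame (s n) (b n)‖ ≤ 1 := fun n =>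
      (CStarAlgebra.norm_le_one_iff_of_nonneg _ (sub_nonneg.2 (D.frame_le_one hE (hb n)))).2
        (sub_le_self _ (D.frame_nonneg hE _ _))
    have hvec : Tendsto (fun n => τ'.vec (1 - D.frame (s n) (b n))) atTop (𝓝 0) := by
      rw [tendsto_zero_iff_norm_tendsto_zero]
      have h1 : Tendsto (fun n => √(1 - (τ'.toLinearMap (D.frame (s n) (b n))).re)) atTop
          (𝓝 0) := by
        have := (Real.continuous_sqrt.tendsto _).comp (hlim.const_sub 1)
        simpa [Function.comp_def] using this
      refine squeeze_zero (fun n => norm_nonneg _) (fun n => Real.le_sqrt_of_sq_le ?_) h1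
      rw [norm_vec_sq]
      refine (τ'.map_re_mono (D.star_one_sub_frame_mul_self_le hE (hb n))).trans (le_of_eq ?_)
      rw [map_sub, τ'.map_one, Complex.sub_re, Complex.one_re]
    have h2 := τ'.tendsto_apply_of_tendsto_vec hb2 hvec (D.vec x)
    rw [tendsto_zero_iff_norm_tendsto_zero] at h2 ⊢
    refine h2.congr fun n => ?_
    rw [← D.norm_vec, map_sub, ← frame_vec, norm_sub_rev]
    rfl

/-! ### Maximal orthogonal families -/

/-- There are orthogonal families that generate a dense `N`-submodule. -/
theorem exists_orthogonal_set_dense (τ' : P.FaithfulNormalTrace) (hNM : N ≤ M)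
    (hM : ∀ x ∈ M, x ∈ M.commutant → ∃ c : ℂ, x = c • (1 : H →L[ℂ] H))
    (hN : ∀ x ∈ N, x ∈ N.commutant → ∃ c : ℂ, x = c • (1 : H →L[ℂ] H)) (hE : τ.IsCondExp N E) :
    ∃ Y : Set M.toStarSubalgebra, (∀ y ∈ Y, ∀ z ∈ Y, y ≠ z → E (y * star z) = 0) ∧
      Dense (Submodule.span ℂ {ξ : 𝓗 | ∃ n : M.toStarSubalgebra, (n : H →L[ℂ] H) ∈ N ∧
        ∃ y ∈ Y, ξ = D.vec (n * y)} : Set 𝓗) := by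
  obtain ⟨Y, hY⟩ := zorn_subset
    {Y : Set M.toStarSubalgebra | ∀ y ∈ Y, ∀ z ∈ Y, y ≠ z → E (y * star z) = 0} (by
      intro c hc hchain
      refine ⟨⋃₀ c, ?_, fun s hs => Set.subset_sUnion_of_mem hs⟩
      rintro y ⟨s, hs, hys⟩ z ⟨t, ht, hzt⟩ hyz
      rcases hchain.total hs ht with hst | hts
      · exact hc ht y (hst hys) z hzt hyz
      · exact hc hs y hys z (hts hzt) hyz)
  refine ⟨Y, hY.prop, ?_⟩
  set W₀ : Submodule ℂ 𝓗 := Submodule.span ℂ {ξ : 𝓗 | ∃ n : M.toStarSubalgebra,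
    (n : H →L[ℂ] H) ∈ N ∧ ∃ y ∈ Y, ξ = D.vec (n * y)} with hW₀
  have hinv : ∀ x : M.toStarSubalgebra, (x : H →L[ℂ] H) ∈ N → ∀ w ∈ W₀, D.left x w ∈ W₀ := by
    intro x hx w hw
    induction hw using Submodule.span_induction with
    | mem w hw =>
      obtain ⟨n, hn, y, hy, rfl⟩ := hw
      rw [left_vec, ← mul_assoc]
      exact Submodule.subset_span ⟨x * n, mul_mem (s := N) hx hn, y, hy, rfl⟩
    | zero => rw [map_zero]; exact zero_mem _
    | add v w _ _ hv hw => rw [map_add]; exact add_mem hv hw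
    | smul c w _ hw => rw [map_smul]; exact Submodule.smul_mem _ c hw
  have hinv' : ∀ x : M.toStarSubalgebra, (x : H →L[ℂ] H) ∈ N → ∀ w ∈ W₀ᗮ, D.left x w ∈ W₀ᗮ := by
    intro x hx w hw v hv
    rw [← star_star x, ← inner_left]
    exact hw _ (hinv _ (star_mem (s := N) hx) v hv)
  have hinv'' : ∀ x : M.toStarSubalgebra, (x : H →L[ℂ] H) ∈ N → ∀ w ∈ W₀ᗮᗮ,
      D.left x w ∈ W₀ᗮᗮ := by
    intro x hx w hw v hv
    rw [← star_star x, ← inner_left]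
    exact hw _ (hinv' _ (star_mem (s := N) hx) v hv)
  have hmem : W₀ᗮ.starProjection ∈ P := by
    refine D.mem_of_commute _ fun x hx => ContinuousLinearMap.ext fun ξ => ?_
    refine (Submodule.eq_starProjection_of_mem_orthogonal
      (hinv' x hx _ (Submodule.starProjection_apply_mem _ ξ)) ?_).symm
    change D.left x ξ - D.left x (W₀ᗮ.starProjection ξ) ∈ _
    rw [← map_sub]
    exact hinv'' x hx _ (Submodule.sub_starProjection_mem_orthogonal ξ)
  -- By push-down, the component of `vec x` orthogonal to `W₀` is `vec z` for some `z` in `M`. Then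
  -- `z` may be added to `Y`, so maximality puts `vec z` in `W₀` as well.
  have hzero : ∀ x, W₀ᗮ.starProjection (D.vec x) = 0 := by
    intro x
    obtain ⟨z, hz, -⟩ := D.exists_vec_eq_apply τ' hNM hM hN hE
      ((⟨W₀ᗮ.starProjection, hmem⟩ : P.toStarSubalgebra) * D.right x)
    rw [coe_mul_apply, right_vec, one_mul] at hz
    change D.vec z = W₀ᗮ.starProjection (D.vec x) at hz
    rw [← hz]
    have hzW : D.vec z ∈ W₀ᗮ := hz ▸ Submodule.starProjection_apply_mem _ _
    have horth : ∀ y ∈ Y, E (z * star y) = 0 := by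
      intro y hy
      refine τ.faithful _ ?_
      -- Pairing `vec z` with this vector of `W₀` gives the squared `‖·‖₂`-norm of `E (z * star y)`.
      have h1 := hzW (D.vec (E (z * star y) * y))
        (Submodule.subset_span ⟨_, hE.mem _, y, hy, rfl⟩)
      rw [inner_vec, star_mul, mul_assoc, τ.map_mul_comm, mul_assoc, ← hE.trace_map,
        ← hE.map_star, hE.map_mul_left (hE.mem _)] at h1
      rwa [← hE.map_star]
    have hins : insert z Y ∈ {Y : Set M.toStarSubalgebra |
        ∀ y ∈ Y, ∀ z ∈ Y, y ≠ z → E (y * star z) = 0} := by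
      rintro y (rfl | hy) w (rfl | hw) hne
      · exact absurd rfl hne
      · exact horth w hw
      · rw [← star_star y, ← star_mul, hE.map_star, horth y hy, star_zero]
      · exact hY.prop y hy w hw hne
    have hzY : z ∈ Y := hY.le_of_ge hins (Set.subset_insert _ _) (Set.mem_insert _ _)
    have h2 := hzW (D.vec z) (Submodule.subset_span ⟨1, one_mem N, z, hzY, by rw [one_mul]⟩)
    exact inner_self_eq_zero.1 h2
  rw [Submodule.dense_iff_topologicalClosure_eq_top, Submodule.topologicalClosure_eq_top_iff,
    Submodule.eq_bot_iff]
  intro w hw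
  rw [← Submodule.starProjection_eq_self_iff.2 hw]
  exact congrFun (D.denseRange_vec.equalizer (W₀ᗮ.starProjection).continuous
    (continuous_const (y := (0 : 𝓗))) (funext hzero)) w

end JonesData

end FaithfulNormalTrace

end VonNeumannAlgebra

/-! ### Normalizing orthogonal families -/

namespace VonNeumannAlgebra

open Filter Topology

variable {H : Type*} [NormedAddCommGroup H] [InnerProductSpace ℂ H] [CompleteSpace H]

namespace FaithfulNormalTrace

variable {M N : VonNeumannAlgebra H} {τ : M.FaithfulNormalTrace}
  {E : M.toStarSubalgebra →ₗ[ℂ] M.toStarSubalgebra}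

namespace IsCondExp

/-- Every element can be normalized on the left by elements of `N`, up to a small error. -/
theorem exists_normalizer (hNM : N ≤ M) (hE : τ.IsCondExp N E) (y : M.toStarSubalgebra) {δ : ℝ}
    (hδ : 0 < δ) :
    ∃ g : M.toStarSubalgebra, (g : H →L[ℂ] H) ∈ N ∧ star g = g ∧
      ‖E (g * y * star (g * y))‖ ≤ 1 ∧
      ‖τ.vec ((1 - E (y * star y) * g * g) * y)‖ ≤ √δ := by
  -- `g` approximates `E(y y*)^(-1/2)`, which need not exist as a bounded operator.
  obtain ⟨g, hg, hg1, hg2⟩ := exists_approx_inv_sqrt (hE.nonneg hNM y) hδ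
  set h : N.toStarSubalgebra := ⟨E (y * star y), hE.mem _⟩ with hh
  have hincl : inclusion hNM h = E (y * star y) := rfl
  have key : ∀ k : N.toStarSubalgebra,
      E (inclusion hNM k * y * star (inclusion hNM k * y)) = inclusion hNM (k * h * star k) := by
    intro k
    rw [map_mul (inclusion hNM), map_mul (inclusion hNM), hincl,
      ← hE.map_mul_mul _ _ _ (inclusion_mem hNM _) (inclusion_mem hNM _), star_mul,
      StarHomClass.map_star]
    simp only [mul_assoc]
  refine ⟨inclusion hNM g, inclusion_mem hNM g, ?_, ?_, Real.le_sqrt_of_sq_le ?_⟩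
  · rw [← StarHomClass.map_star, hg]
  · rw [key, norm_inclusion, hg]
    exact hg1
  · have h1 : 1 - E (y * star y) * inclusion hNM g * inclusion hNM g =
        inclusion hNM (1 - h * g * g) := by
      rw [map_sub, _root_.map_one (inclusion hNM), map_mul (inclusion hNM),
        map_mul (inclusion hNM), hincl]
    rw [h1, norm_vec_sq, τ.map_mul_comm, ← hE.trace_map, key]
    refine (Complex.re_le_norm _).trans ((τ.norm_map_le _).trans ?_)
    rw [norm_inclusion]
    exact hg2

end IsCondExp

namespace JonesData

variable {𝓗 : Type*} [NormedAddCommGroup 𝓗] [InnerProductSpace ℂ 𝓗] [CompleteSpace 𝓗]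
  {P : VonNeumannAlgebra 𝓗} (D : τ.JonesData N E P)

/-- When the commutant of `N` is finite, there are orthogonal families whose frame operators have
trace close to one. -/
theorem exists_subOrthonormal (τ' : P.FaithfulNormalTrace) (hNM : N ≤ M)
    (hM : ∀ x ∈ M, x ∈ M.commutant → ∃ c : ℂ, x = c • (1 : H →L[ℂ] H))
    (hN : ∀ x ∈ N, x ∈ N.commutant → ∃ c : ℂ, x = c • (1 : H →L[ℂ] H)) (hE : τ.IsCondExp N E) :
    ∃ (Y : Set M.toStarSubalgebra) (s : ℕ → Finset Y) (b : ℕ → Y → M.toStarSubalgebra),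
      (∀ n, IsSubOrthonormal E (s n) (b n)) ∧
        Tendsto (fun n => (τ'.toLinearMap (D.frame (s n) (b n))).re) atTop (𝓝 1) := by
  classical
  obtain ⟨Y, hY, hdense⟩ := D.exists_orthogonal_set_dense τ' hNM hM hN hE
  have hδ : ∀ k : ℕ, (0 : ℝ) < 1 / (k + 1) := fun k => by positivity
  choose g hgN hgs hg1 hg2 using fun (y : Y) (k : ℕ) =>
    hE.exists_normalizer hNM (y : M.toStarSubalgebra) (hδ k)
  set b : ℕ → Y → M.toStarSubalgebra := fun k y => g y k * y with hb
  have hsub : ∀ (F : Finset Y) (k : ℕ), IsSubOrthonormal E F (b k) := fun F k =>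
    { orthogonal := fun y _ z _ hyz => by
        have h1 : g y k * (y : M.toStarSubalgebra) * star (g z k * (z : M.toStarSubalgebra)) =
            g y k * (y * star (z : M.toStarSubalgebra)) * g z k := by
          rw [star_mul, hgs]; simp only [mul_assoc]
        rw [hb, h1, hE.map_mul_mul _ _ _ (hgN y k) (hgN z k),
          hY _ y.2 _ z.2 fun h => hyz (Subtype.ext h), mul_zero, zero_mul]
      norm_le_one := fun y _ => hg1 y k }
  -- A net, since `Y` may be uncountable. On `vec (n * y)` only the term of `y` survives once `y`
  -- lies in the finite set, and the error of normalization is at most `‖n‖ √(1 / (k + 1))`.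
  have hstrong : ∀ ξ, Tendsto (fun p : Finset Y × ℕ => (D.frame p.1 (b p.2) : 𝓗 →L[ℂ] 𝓗) ξ)
      atTop (𝓝 ξ) := by
    refine tendsto_clm_apply_of_dense (S := 1)
      (fun p : Finset Y × ℕ => D.norm_frame_le_one hE (hsub p.1 p.2)) hdense fun ξ hξ => ?_
    induction hξ using Submodule.span_induction with
    | mem ξ hξ =>
      obtain ⟨n, hn, y, hy, rfl⟩ := hξ
      change Tendsto _ _ (𝓝 (D.vec (n * y)))
      rw [tendsto_iff_norm_sub_tendsto_zero]
      have hlim : Tendsto (fun p : Finset Y × ℕ => ‖n‖ * √(1 / ((p.2 : ℝ) + 1))) atTop (𝓝 0) := by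
        have h1 := (Real.continuous_sqrt.tendsto _).comp
          (tendsto_one_div_add_atTop_nhds_zero_nat (𝕜 := ℝ))
        rw [Real.sqrt_zero] at h1
        have h2 := (h1.comp (tendsto_snd (f := (atTop : Filter (Finset Y))))).const_mul ‖n‖
        rw [mul_zero, prod_atTop_atTop_eq] at h2
        exact h2
      refine squeeze_zero' (Eventually.of_forall fun _ => norm_nonneg _) ?_ hlim
      filter_upwards [eventually_ge_atTop (({⟨y, hy⟩} : Finset Y), 0)] with p hp
      have hyp : (⟨y, hy⟩ : Y) ∈ p.1 := hp.1 (Finset.mem_singleton_self _)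
      have hterm : ∀ z : Y, E (n * y * star (b p.2 z)) * b p.2 z =
          n * E (y * star (z : M.toStarSubalgebra)) * g z p.2 * g z p.2 * z := by
        intro z
        have h1 : n * y * star (b p.2 z) = n * (y * star (z : M.toStarSubalgebra)) * g z p.2 := by
          rw [hb, star_mul, hgs]; simp only [mul_assoc]
        rw [h1, hE.map_mul_mul _ _ _ hn (hgN z _)]
        simp only [hb, mul_assoc]
      have hsum : ∑ z ∈ p.1, E (n * y * star (b p.2 z)) * b p.2 z =
          n * E (y * star y) * g ⟨y, hy⟩ p.2 * g ⟨y, hy⟩ p.2 * y := by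
        rw [Finset.sum_eq_single_of_mem _ hyp fun z _ hz => ?_, hterm]
        rw [hterm, hY _ hy _ z.2 fun h => hz (Subtype.ext h.symm)]
        simp only [mul_zero, zero_mul]
      rw [frame_vec, hsum, ← map_sub, D.norm_vec, ← norm_neg, ← FaithfulNormalTrace.vecLin_apply,
        ← map_neg, FaithfulNormalTrace.vecLin_apply]
      have h3 : -(n * E (y * star y) * g ⟨y, hy⟩ p.2 * g ⟨y, hy⟩ p.2 * y - n * y) =
          n * ((1 - E (y * star y) * g ⟨y, hy⟩ p.2 * g ⟨y, hy⟩ p.2) * y) := by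
        noncomm_ring
      rw [h3]
      refine (τ.norm_vec_mul_le _ _).trans ?_
      gcongr
      exact hg2 ⟨y, hy⟩ p.2
    | zero => simp only [map_zero]; exact tendsto_const_nhds
    | add v w _ _ hv hw => simp only [map_add]; exact hv.add hw
    | smul c w _ hw => simp only [map_smul]; exact hw.const_smul c
  have htrace : Tendsto (fun p : Finset Y × ℕ => (τ'.toLinearMap (D.frame p.1 (b p.2))).re)
      atTop (𝓝 1) := by
    have h1 := τ'.tendsto_of_weak (y := 1)
      (fun p : Finset Y × ℕ => D.norm_frame_le_one hE (hsub p.1 p.2))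
      fun ξ η => tendsto_const_nhds.inner (hstrong ξ)
    rw [τ'.map_one] at h1
    exact (Complex.continuous_re.tendsto _).comp h1
  -- Only the traces have to converge from here on, so a sequence can be picked from the net.
  have hex : ∀ n : ℕ, ∃ p : Finset Y × ℕ,
      1 - 1 / ((n : ℝ) + 1) < (τ'.toLinearMap (D.frame p.1 (b p.2))).re := fun n =>
    (htrace.eventually (lt_mem_nhds (sub_lt_self 1 (hδ n)))).exists
  choose p hp using hex
  refine ⟨Y, fun n => (p n).1, fun n => b (p n).2, fun n => hsub _ _, ?_⟩
  refine tendsto_of_tendsto_of_tendsto_of_le_of_le (g := fun n : ℕ => 1 - 1 / ((n : ℝ) + 1))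
    (h := fun _ => 1) ?_ tendsto_const_nhds (fun n => (hp n).le) fun n => ?_
  · simpa using (tendsto_one_div_add_atTop_nhds_zero_nat (𝕜 := ℝ)).const_sub 1
  · have := τ'.map_re_mono (D.frame_le_one hE (hsub (p n).1 (p n).2))
    rwa [τ'.map_one, Complex.one_re] at this

end JonesData

end FaithfulNormalTrace

end VonNeumannAlgebra

namespace VonNeumannAlgebra

open Filter Topology

variable {H : Type*} [NormedAddCommGroup H] [InnerProductSpace ℂ H] [CompleteSpace H]

/-! ### Strong closures -/

theorem mem_strongClosure_of_tendsto {ι : Type*} {l : Filter ι} [l.NeBot] {S : Set (H →L[ℂ] H)}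
    {T : ι → H →L[ℂ] H} {A : H →L[ℂ] H} (hT : ∀ i, T i ∈ S)
    (h : ∀ ξ, Tendsto (fun i => T i ξ) l (𝓝 (A ξ))) : A ∈ strongClosure S := by
  have h1 : Tendsto (fun i => (ContinuousLinearMap.toPointwiseConvergenceCLM ℂ (RingHom.id ℂ) H H
      (T i) : H →Lₚₜ[ℂ] H)) l
      (𝓝 (ContinuousLinearMap.toPointwiseConvergenceCLM ℂ (RingHom.id ℂ) H H A)) :=
    PointwiseConvergenceCLM.tendsto_iff_forall_tendsto.2 h
  have h2 : (ContinuousLinearMap.toPointwiseConvergenceCLM ℂ (RingHom.id ℂ) H H A :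
      H →Lₚₜ[ℂ] H) ∈ closure
        (ContinuousLinearMap.toPointwiseConvergenceCLM ℂ (RingHom.id ℂ) H H '' S) :=
    mem_closure_of_tendsto h1 (Eventually.of_forall fun i => ⟨T i, hT i, rfl⟩)
  exact h2

/-- By the bicommutant property, membership in `M` is commutation with `M.commutant`, a pointwise
closed condition. -/
theorem strongClosure_subset (M : VonNeumannAlgebra H) {S : Set (H →L[ℂ] H)} (hS : S ⊆ M) :
    strongClosure S ⊆ M := by
  intro T hT
  have hcont : ∀ ξ : H, Continuous fun T : H →Lₚₜ[ℂ] H => T ξ := fun ξ =>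
    (PointwiseConvergenceCLM.evalCLM (RingHom.id ℂ) H ξ).continuous
  have hcl : IsClosed {T : H →Lₚₜ[ℂ] H | ∀ g ∈ M.commutant, ∀ ξ, T (g ξ) = g (T ξ)} := by
    simp only [Set.ofPred_forall]
    exact isClosed_iInter fun g => isClosed_iInter fun _ => isClosed_iInter fun ξ =>
      isClosed_eq (hcont _) (g.continuous.comp (hcont ξ))
  have h1 : ∀ g ∈ M.commutant, ∀ ξ, T (g ξ) = g (T ξ) := by
    refine closure_minimal ?_ hcl hT
    rintro _ ⟨A, hA, rfl⟩ g hg ξ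
    exact congrArg (fun B : H →L[ℂ] H => B ξ) (mem_commutant_iff.1 hg A (hS hA))
  rw [SetLike.mem_coe, ← M.commutant_commutant, mem_commutant_iff]
  exact fun g hg => ContinuousLinearMap.ext fun ξ => (h1 g hg ξ).symm

theorem span_mul_subset {M K L : VonNeumannAlgebra H} (hK : K ≤ M) (hL : L ≤ M) :
    (Submodule.span ℂ ((K : Set (H →L[ℂ] H)) * (L : Set (H →L[ℂ] H))) : Set (H →L[ℂ] H)) ⊆ M := by
  have h : Submodule.span ℂ ((K : Set (H →L[ℂ] H)) * (L : Set (H →L[ℂ] H))) ≤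
      M.toStarSubalgebra.toSubalgebra.toSubmodule := by
    refine Submodule.span_le.2 ?_
    rintro _ ⟨a, ha, b, hb, rfl⟩
    exact mul_mem (s := M) (hK ha) (hL hb)
  exact h

namespace FaithfulNormalTrace

variable {M N K L : VonNeumannAlgebra H} {τ : M.FaithfulNormalTrace}
  {E : M.toStarSubalgebra →ₗ[ℂ] M.toStarSubalgebra}

/-- Elements that are bounded `L²`-limits of sequences in `S` lie in the strong closure of `S`. -/
theorem mem_strongClosure_of_tendsto_vec (τ : M.FaithfulNormalTrace) {S : Set (H →L[ℂ] H)}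
    {x : ℕ → M.toStarSubalgebra} {y : M.toStarSubalgebra} {C : ℝ}
    (hx : ∀ n, (x n : H →L[ℂ] H) ∈ S) (hC : ∀ n, ‖x n‖ ≤ C)
    (h : Tendsto (fun n => τ.vec (x n - y)) atTop (𝓝 0)) : (y : H →L[ℂ] H) ∈ strongClosure S := by
  refine mem_strongClosure_of_tendsto (l := atTop) (T := fun n => (x n : H →L[ℂ] H)) hx fun ξ => ?_
  rw [tendsto_iff_norm_sub_tendsto_zero]
  have h1 := τ.tendsto_apply_of_tendsto_vec (C := C + ‖y‖)
    (fun n => (norm_sub_le _ _).trans (by gcongr; exact hC n)) h ξ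
  exact tendsto_zero_iff_norm_tendsto_zero.1 h1

/-- Without a trace on the commutant the index is `⊤` by definition; otherwise it is computed with a
chosen trace, which serves as `τ'`. -/
theorem exists_trace_of_jonesIndex_ne_top (hE : τ.IsCondExp N E) (h : τ.jonesIndex N ≠ ⊤) :
    ∃ τ' : (τ.commutantL2 N).FaithfulNormalTrace, τ.jonesIndex N =
      (ENNReal.ofReal (τ'.toLinearMap (jonesData τ hE).jones).re)⁻¹ := by
  unfold jonesIndex at h ⊢
  split_ifs at h ⊢ with hne
  · exact ⟨hne.some, rfl⟩
  · exact absurd rfl h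

namespace IsCondExp

/-- The trace-preserving conditional expectation is unique. -/
theorem unique {E₁ E₂ : M.toStarSubalgebra →ₗ[ℂ] M.toStarSubalgebra} (h₁ : τ.IsCondExp N E₁)
    (h₂ : τ.IsCondExp N E₂) : E₁ = E₂ :=
  LinearMap.ext fun x => τ.vec_injective (by rw [← h₁.jonesProj_vec, h₂.jonesProj_vec])

/-- The restriction of the conditional expectation to an intermediate algebra. -/
theorem exists_restrict (hE : τ.IsCondExp N E) (hNK : N ≤ K) (hKM : K ≤ M) :
    ∃ E' : K.toStarSubalgebra →ₗ[ℂ] K.toStarSubalgebra, (τ.restrict hKM).IsCondExp N E' ∧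
      ∀ x, inclusion hKM (E' x) = E (inclusion hKM x) := by
  have hinj : Function.Injective (inclusion hKM) := fun x y h =>
    Subtype.ext (congrArg (fun z : M.toStarSubalgebra => (z : H →L[ℂ] H)) h)
  let F : K.toStarSubalgebra → K.toStarSubalgebra := fun x => ⟨E (inclusion hKM x), hNK (hE.mem _)⟩
  have hF : ∀ x, inclusion hKM (F x) = E (inclusion hKM x) := fun x => rfl
  let E' : K.toStarSubalgebra →ₗ[ℂ] K.toStarSubalgebra :=
    { toFun := F
      map_add' := fun x y => hinj (by rw [hF, map_add (inclusion hKM), map_add, map_add, hF, hF])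
      map_smul' := fun c x => hinj (by
        rw [hF, map_smul (inclusion hKM), map_smul, map_smul, hF, RingHom.id_apply]) }
  have hE' : ∀ x, inclusion hKM (E' x) = E (inclusion hKM x) := fun x => rfl
  refine ⟨E', ?_, hE'⟩
  exact
    { mem := fun x => hE.mem _
      eq_self := fun x hx => hinj (by rw [hE', hE.eq_self _ hx])
      map_star := fun x => hinj (by
        rw [hE', StarHomClass.map_star (inclusion hKM), StarHomClass.map_star (inclusion hKM), hE',
          hE.map_star])
      map_mul_mul := fun a x b ha hb => hinj (by
        rw [hE', map_mul (inclusion hKM), map_mul (inclusion hKM), map_mul (inclusion hKM),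
          map_mul (inclusion hKM), hE', hE.map_mul_mul _ _ _ ha hb])
      trace_map := fun x => hE.trace_map _ }

end IsCondExp

/-- If the frame operator of a family `b` fixes each `b i` and has trace one, it is the
identity. -/
theorem JonesData.eq_frame_expansion {𝓗 : Type*} [NormedAddCommGroup 𝓗] [InnerProductSpace ℂ 𝓗]
    [CompleteSpace 𝓗] {P : VonNeumannAlgebra 𝓗} (D : τ.JonesData N E P)
    (τ' : P.FaithfulNormalTrace) (hE : τ.IsCondExp N E) {ι : Type*} (s : Finset ι)
    (b : ι → M.toStarSubalgebra) (hb : ∀ i, ∑ j ∈ s, E (b i * star (b j)) * b j = b i)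
    (htr : τ'.toLinearMap (D.frame s b) = 1) (x : M.toStarSubalgebra) :
    x = ∑ i ∈ s, E (x * star (b i)) * b i := by
  -- Expansions have coefficients in `N` on the left and `E` is left `N`-linear, so fixing every `b
  -- i` means fixing every expansion.
  have hidem : D.frame s b * D.frame s b = D.frame s b := by
    refine D.ext fun x => ?_
    rw [coe_mul_apply, frame_vec, frame_vec]
    congr 1
    have h1 : ∀ j, E ((∑ i ∈ s, E (x * star (b i)) * b i) * star (b j)) * b j =
        ∑ i ∈ s, E (x * star (b i)) * (E (b i * star (b j)) * b j) := fun j => by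
      rw [Finset.sum_mul, map_sum, Finset.sum_mul]
      refine Finset.sum_congr rfl fun i _ => ?_
      rw [mul_assoc, hE.map_mul_left (hE.mem _), mul_assoc]
    simp only [h1]
    rw [Finset.sum_comm]
    refine Finset.sum_congr rfl fun i _ => ?_
    rw [← Finset.mul_sum, hb]
  have hone : 1 - D.frame s b = 0 := by
    refine τ'.faithful _ ?_
    have h2 : star (1 - D.frame s b) * (1 - D.frame s b) = 1 - D.frame s b := by
      rw [star_sub, star_one, D.star_frame hE, sub_mul, one_mul, mul_sub, mul_one, hidem, sub_self,
        sub_zero]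
    rw [h2, map_sub, htr, τ'.map_one, sub_self]
  refine D.vec_injective ?_
  rw [← frame_vec, ← sub_eq_zero.1 hone]
  rfl

/-! ### Commuting squares -/

section CommutingSquare

variable {𝓗₁ 𝓗₂ : Type*} [NormedAddCommGroup 𝓗₁] [InnerProductSpace ℂ 𝓗₁] [CompleteSpace 𝓗₁]
  [NormedAddCommGroup 𝓗₂] [InnerProductSpace ℂ 𝓗₂] [CompleteSpace 𝓗₂]
  {P₁ : VonNeumannAlgebra 𝓗₁} {P₂ : VonNeumannAlgebra 𝓗₂} {hKM : K ≤ M}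
  {EL : M.toStarSubalgebra →ₗ[ℂ] M.toStarSubalgebra}
  {EN : K.toStarSubalgebra →ₗ[ℂ] K.toStarSubalgebra}

/-- In a commuting square with equal indices, frame operators for `N ⊆ K` and for `L ⊆ M` have
the same trace. -/
theorem map_frame_inclusion (D₁ : (τ.restrict hKM).JonesData N EN P₁) (D₂ : τ.JonesData L EL P₂)
    (τ₁ : P₁.FaithfulNormalTrace) (τ₂ : P₂.FaithfulNormalTrace) (hNK : N ≤ K) (hLM : L ≤ M)
    (hN : ∀ x ∈ N, x ∈ N.commutant → ∃ c : ℂ, x = c • (1 : H →L[ℂ] H))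
    (hL : ∀ x ∈ L, x ∈ L.commutant → ∃ c : ℂ, x = c • (1 : H →L[ℂ] H))
    (hEN : (τ.restrict hKM).IsCondExp N EN) (hEL : τ.IsCondExp L EL)
    (hjones : (τ₁.toLinearMap D₁.jones).re = (τ₂.toLinearMap D₂.jones).re)
    {ι : Type*} (s : Finset ι) (b : ι → K.toStarSubalgebra) :
    τ₂.toLinearMap (D₂.frame s fun i => inclusion hKM (b i)) = τ₁.toLinearMap (D₁.frame s b) := by
  rw [D₂.map_frame τ₂ hLM hL hEL, D₁.map_frame τ₁ hNK hN hEN, D₁.map_jones_eq_re τ₁ hEN,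
    D₂.map_jones_eq_re τ₂ hEL, hjones]
  rfl

/-- In a commuting square with equal finite indices, every element of `M` is a bounded `L²`-limit
of sums of products of elements of `L` and `K`. -/
theorem exists_tendsto_sum_mul (D₁ : (τ.restrict hKM).JonesData N EN P₁)
    (D₂ : τ.JonesData L EL P₂) (τ₁ : P₁.FaithfulNormalTrace) (τ₂ : P₂.FaithfulNormalTrace)
    (hNK : N ≤ K) (hLM : L ≤ M)
    (hM : ∀ x ∈ M, x ∈ M.commutant → ∃ c : ℂ, x = c • (1 : H →L[ℂ] H))
    (hK : ∀ x ∈ K, x ∈ K.commutant → ∃ c : ℂ, x = c • (1 : H →L[ℂ] H))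
    (hN : ∀ x ∈ N, x ∈ N.commutant → ∃ c : ℂ, x = c • (1 : H →L[ℂ] H))
    (hL : ∀ x ∈ L, x ∈ L.commutant → ∃ c : ℂ, x = c • (1 : H →L[ℂ] H))
    (hEN : (τ.restrict hKM).IsCondExp N EN) (hEL : τ.IsCondExp L EL)
    (hcomm : ∀ x, EL (inclusion hKM x) = inclusion hKM (EN x))
    (hjones : (τ₁.toLinearMap D₁.jones).re = (τ₂.toLinearMap D₂.jones).re)
    (x : M.toStarSubalgebra) :
    ∃ (z : ℕ → M.toStarSubalgebra) (C : ℝ),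
      (∀ n, (z n : H →L[ℂ] H) ∈
        Submodule.span ℂ ((L : Set (H →L[ℂ] H)) * (K : Set (H →L[ℂ] H)))) ∧
      (∀ n, (star (z n) : H →L[ℂ] H) ∈
        Submodule.span ℂ ((K : Set (H →L[ℂ] H)) * (L : Set (H →L[ℂ] H)))) ∧
      (∀ n, ‖z n‖ ≤ C) ∧ Tendsto (fun n => τ.vec (z n - x)) atTop (𝓝 0) := by
  obtain ⟨Y, s, b, hb, hlim⟩ := D₁.exists_subOrthonormal τ₁ hNK hK hN hEN
  have hcomm' : ∀ x y : K.toStarSubalgebra,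
      EL (inclusion hKM x * star (inclusion hKM y)) = inclusion hKM (EN (x * star y)) :=
    fun x y => by
      rw [← StarHomClass.map_star (inclusion hKM), ← map_mul (inclusion hKM), hcomm]
  -- The products `b i (b j)*` stay in `K`, where the expectation onto `L` agrees with that onto
  -- `N`.
  have hb' : ∀ n, IsSubOrthonormal EL (s n) fun i => inclusion hKM (b n i) := fun n =>
    { orthogonal := fun i hi j hj hij => by
        rw [hcomm', (hb n).orthogonal i hi j hj hij, map_zero]
      norm_le_one := fun i hi => by
        rw [hcomm', norm_inclusion]
        exact (hb n).norm_le_one i hi }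
  simp only [← map_frame_inclusion D₁ D₂ τ₁ τ₂ hNK hLM hN hL hEN hEL hjones] at hlim
  obtain ⟨⟨C, hC⟩, hx⟩ := D₂.frame_expansion_tendsto τ₂ hLM hM hL hEL s _ hb' hlim x
  refine ⟨_, C, fun n => ?_, fun n => ?_, hC, hx⟩
  · rw [AddSubmonoidClass.coe_finsetSum]
    exact Submodule.sum_mem _ fun i _ => Submodule.subset_span
      (Set.mul_mem_mul (hEL.mem _) (inclusion_mem hKM _))
  · rw [AddSubmonoidClass.coe_finsetSum, star_sum]
    exact Submodule.sum_mem _ fun i _ => by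
      change star ((EL _ : H →L[ℂ] H) * (inclusion hKM (b n i) : H →L[ℂ] H)) ∈ _
      rw [star_mul]
      exact Submodule.subset_span (Set.mul_mem_mul (star_mem (s := K) (inclusion_mem hKM _))
        (star_mem (s := L) (hEL.mem _)))

/-- In a commuting square with equal finite indices, a Pimsner–Popa basis of `K` over `N` also
expands the elements of `M` over `L`. -/
theorem JonesData.eq_frame_expansion_of_basis (D₁ : (τ.restrict hKM).JonesData N EN P₁)
    (D₂ : τ.JonesData L EL P₂) (τ₁ : P₁.FaithfulNormalTrace) (τ₂ : P₂.FaithfulNormalTrace)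
    (hNK : N ≤ K) (hLM : L ≤ M)
    (hN : ∀ x ∈ N, x ∈ N.commutant → ∃ c : ℂ, x = c • (1 : H →L[ℂ] H))
    (hL : ∀ x ∈ L, x ∈ L.commutant → ∃ c : ℂ, x = c • (1 : H →L[ℂ] H))
    (hEN : (τ.restrict hKM).IsCondExp N EN) (hEL : τ.IsCondExp L EL)
    (hcomm : ∀ x, EL (inclusion hKM x) = inclusion hKM (EN x))
    (hjones : (τ₁.toLinearMap D₁.jones).re = (τ₂.toLinearMap D₂.jones).re) {n : ℕ}
    (b : Fin n → K.toStarSubalgebra) (hb : ∀ x, x = ∑ i, EN (x * star (b i)) * b i)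
    (x : M.toStarSubalgebra) :
    x = ∑ i, EL (x * star (inclusion hKM (b i))) * inclusion hKM (b i) := by
  refine D₂.eq_frame_expansion τ₂ hEL Finset.univ (fun i => inclusion hKM (b i)) (fun i => ?_) ?_ x
  · conv_rhs => rw [hb (b i), map_sum]
    refine Finset.sum_congr rfl fun j _ => ?_
    rw [← StarHomClass.map_star (inclusion hKM), ← map_mul (inclusion hKM), hcomm,
      ← map_mul (inclusion hKM)]
  · have h1 : D₁.frame Finset.univ b = 1 := D₁.ext fun x => by
      rw [frame_vec, ← hb x]; rfl
    rw [map_frame_inclusion D₁ D₂ τ₁ τ₂ hNK hLM hN hL hEN hEL hjones, h1, τ₁.map_one]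

end CommutingSquare

end FaithfulNormalTrace

end VonNeumannAlgebra

/-! ### The main theorem -/

open VonNeumannAlgebra FaithfulNormalTrace Filter Topology in
theorem mainTheorem7 {H : Type*} [NormedAddCommGroup H] [InnerProductSpace ℂ H] [CompleteSpace H]
    (M K L N : VonNeumannAlgebra H)
    (hM : M.IsII1Factor) (hK : K.IsII1Factor) (hL : L.IsII1Factor) (hN : N.IsII1Factor)
    (τ : M.FaithfulNormalTrace) (hsq : τ.IsCommutingSquare N K L)
    (hfin : (τ.restrict hsq.K_le_M).jonesIndex N ≠ ⊤)
    (hindex : (τ.restrict hsq.K_le_M).jonesIndex N = τ.jonesIndex L) :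
    VonNeumannAlgebra.IsNondegenerate M K L ∧
      ∀ (n : ℕ) (b : Fin n → K.toStarSubalgebra),
        (τ.restrict hsq.K_le_M).IsPimsnerPopaBasis N b →
          τ.IsPimsnerPopaBasis L
            (fun i => (⟨(b i : H →L[ℂ] H), hsq.K_le_M (b i).2⟩ : M.toStarSubalgebra)) := by
  obtain ⟨EN, EK, EL, hEN, hEK, hEL, -, hLK⟩ := hsq.commute
  have hKM := hsq.K_le_M
  have hLM := hsq.L_le_M
  have hNK := hsq.N_le_K
  obtain ⟨E, hE, hEincl⟩ := hEN.exists_restrict hNK hKM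
  have hcomm : ∀ x, EL (inclusion hKM x) = inclusion hKM (E x) := fun x => by
    rw [hEincl, ← hLK, LinearMap.comp_apply, hEK.eq_self _ (inclusion_mem hKM x)]
  obtain ⟨τ₁, hτ₁⟩ := exists_trace_of_jonesIndex_ne_top hE hfin
  obtain ⟨τ₂, hτ₂⟩ := exists_trace_of_jonesIndex_ne_top hEL (hindex ▸ hfin)
  -- Both indices are inverses of these traces; positivity allows `ENNReal.ofReal` to be removed.
  have hjones : (τ₁.toLinearMap (jonesData (τ.restrict hKM) hE).jones).re =
      (τ₂.toLinearMap (jonesData τ hEL).jones).re := by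
    exact (ENNReal.ofReal_eq_ofReal_iff (JonesData.map_jones_pos _ τ₁ hE).le
      (JonesData.map_jones_pos _ τ₂ hEL).le).1 (inv_inj.1 (hτ₁.symm.trans (hindex.trans hτ₂)))
  constructor
  · have happrox := exists_tendsto_sum_mul _ _ τ₁ τ₂ hNK hLM hM.center_trivial hK.center_trivial
      hN.center_trivial hL.center_trivial hE hEL hcomm hjones
    refine ⟨subset_antisymm (M.strongClosure_subset (span_mul_subset hKM hLM)) fun x hx => ?_,
      subset_antisymm (M.strongClosure_subset (span_mul_subset hLM hKM)) fun x hx => ?_⟩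
    -- Adjoints of approximants of `star x` lie in the span of `KL`, and the adjoint preserves both
    -- norms.
    · obtain ⟨z, C, -, hz, hC, hlim⟩ := happrox (star ⟨x, hx⟩)
      refine τ.mem_strongClosure_of_tendsto_vec (x := fun n => star (z n)) (y := ⟨x, hx⟩) (C := C)
        hz (fun n => (norm_star _).trans_le (hC n)) ?_
      rw [tendsto_zero_iff_norm_tendsto_zero] at hlim ⊢
      refine hlim.congr fun n => ?_
      rw [← norm_vec_star, star_sub, star_star]
    · obtain ⟨z, C, hz, -, hC, hlim⟩ := happrox ⟨x, hx⟩
      exact τ.mem_strongClosure_of_tendsto_vec (y := ⟨x, hx⟩) hz hC hlim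
  · rintro n b ⟨E₀, hE₀, hb⟩
    obtain rfl := hE₀.unique hE
    exact ⟨EL, hEL, JonesData.eq_frame_expansion_of_basis (jonesData (τ.restrict hKM) hE)
      (jonesData τ hEL) τ₁ τ₂ hNK hLM hN.center_trivial hL.center_trivial hE hEL hcomm hjones b hb⟩
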